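/- Let $0<s<1$, $G_s=\{z\in\mathbb C: s<|z|<1\}$, $\partial G_s=s\mathbb T\cup\mathbb T$. Let $H^\infty(G_s)$ be the space of bounded analytic functions on $G_s$; such a function has radial boundary values almost everywhere on both circles, and boundary norms refer to these boundary values. $\|\cdot\|_{L^\infty(\partial G_s)}$ denotes the essential supremum over $\partial G_s$. For $k\ge 1$ let $H^{k,\infty}(G_s)=\{f: f^{(j)}\in H^\infty(G_s),\ 0\le j\le k\}$, with the norm $$\|f\|_{H^{k,\infty}(G_s)}=\max_{0\le j\le k}\bigl(\|f^{(j)}\|_{L^\infty(s\mathbb T)}+\|f^{(j)}\|_{L^\infty(\mathbb T)}\bigr),$$ and let $\mathcal B_{k,\infty}$ be its closed unit ball. For a nonempty connected relatively open subset $I$ of $\partial G_s$, contained in the circle of radius $r\in\{s,1\}$, let $\lambda\in(0,1]$ be the proportion of that circle occupied by $I$, i.e. $2\pi\lambda$ is the Lebesgue measure of $\{\theta\in(-\pi,\pi]: re^{i\theta}\in I\}$, and let $\|f\|_{L^1(I)}=\frac1{2\pi\lambda}\int_I|f(re^{i\theta})|\,d\theta$. Finally let $q_0=-\log s$ and $$C_s=\inf_{|t|\le\pi}\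 \frac1{2q_0}\sum_{j\in\mathbb Z}\frac1{1+\cosh\left(\frac{\pi}{q_0}(t+2\pi j)\right)} .$$ **Theorem.** Let $k\ge1$ and $0<s<1$. (1) For every $\lambda\in(0,1]$ there is a constant $C\ge0$, depending only on $k$, $s$ and $\lambda$, such that for every $I$ as above of proportion $\lambda$ and every $f\in\mathcal B_{k,\infty}$ with $\|f\|_{L^1(I)}<e^{-q_0/(\lambda C_s)}$, $$\|f\|_{L^\infty(\partial G_s)}\le\frac{C}{\bigl|\log\|f\|_{L^1(I)}\bigr|^k}$$ (for $f\equiv0$ the right-hand side is read as $0$). (2) There is a sequence $f_n\in\mathcal B_{k,\infty}$ for which $\lim_{n\to\infty}\|f_n\|_{L^\infty(\mathbb T)}\bigl|\log\|f_n\|_{L^1(\mathbb T)}\bigr|^k$ exists and is at least $s|\log s|^k$. (3) The exponent $k$ is optimal: there is a sequence $f_n\in\mathcal B_{k,\infty}$ with $\|f_n\|_{L^1(\mathbb T)}>0$ for all $n$ and $\|f_n\|_{L^1(\mathbb T)}\to0$, for which $\lim_{n\to\infty}\|f_n\|_{L^\infty(\partial G_s)}\bigl|\log\|f_n\|_{L^1(\mathbb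 T)}\bigr|^k$ exists and is at least $s^k|\log s|^k$. -/

import Mathlib

open scoped ENNReal Topology

noncomputable section

namespace HardyAnnulus

/-- The open annulus `G_s = {z : s < |z| < 1}`. -/
def annulus (s : ℝ) : Set ℂ := {z | s < ‖z‖ ∧ ‖z‖ < 1}

/-- The boundary of the annulus, `s𝕋 ∪ 𝕋`. -/
def boundary (s : ℝ) : Set ℂ := Metric.sphere 0 s ∪ Metric.sphere 0 1

/-- The point of modulus `r` and argument `θ`. -/
def pt (r θ : ℝ) : ℂ := (r : ℂ) * Complex.exp ((θ : ℂ) * Complex.I)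

/-- `H^∞(G_s)`: bounded analytic functions on the annulus. -/
def MemHInf (s : ℝ) (g : ℂ → ℂ) : Prop :=
  DifferentiableOn ℂ g (annulus s) ∧ ∃ M : ℝ, ∀ z ∈ annulus s, ‖g z‖ ≤ M

/-- The boundary values of `g` on the circle of radius `ρ` (`ρ = s` or `ρ = 1`), as a function of
the angle: the radial limit from inside the annulus. For bounded analytic `g` it exists for almost
every angle. -/
def trace (s ρ : ℝ) (g : ℂ → ℂ) (θ : ℝ) : ℂ :=
  Filter.limUnder (𝓝[Set.Ioo s 1] ρ) (fun r : ℝ => g (pt r θ))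

/-- The `L^∞` norm of the boundary values of `g` on the circle of radius `ρ`. -/
def linftyCircle (s ρ : ℝ) (g : ℂ → ℂ) : ℝ≥0∞ :=
  MeasureTheory.eLpNorm (trace s ρ g) ∞ (MeasureTheory.volume.restrict (Set.Ioc (-Real.pi) Real.pi))

/-- The `L^∞` norm of the boundary values of `g` on `∂G_s = s𝕋 ∪ 𝕋`. -/
def linftyBoundary (s : ℝ) (g : ℂ → ℂ) : ℝ≥0∞ :=
  max (linftyCircle s s g) (linftyCircle s 1 g)

/-- The Hardy-Sobolev space `H^{k,∞}(G_s)`. -/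
def MemHardySobolev (k : ℕ) (s : ℝ) (f : ℂ → ℂ) : Prop :=
  ∀ j ≤ k, MemHInf s (iteratedDeriv j f)

/-- The norm of `H^{k,∞}(G_s)`: the maximum over `0 ≤ j ≤ k` of
`‖f^{(j)}‖_{L^∞(s𝕋)} + ‖f^{(j)}‖_{L^∞(𝕋)}`. -/
def hardySobolevNorm (k : ℕ) (s : ℝ) (f : ℂ → ℂ) : ℝ≥0∞ :=
  (Finset.range (k + 1)).sup fun j =>
    linftyCircle s s (iteratedDeriv j f) + linftyCircle s 1 (iteratedDeriv j f)

/-- The closed unit ball of `H^{k,∞}(G_s)`. -/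
def unitBall (k : ℕ) (s : ℝ) : Set (ℂ → ℂ) :=
  {f | MemHardySobolev k s f ∧ hardySobolevNorm k s f ≤ 1}

/-- `I` is a (nonempty) connected, relatively open subset of `∂G_s`, lying on the circle of
radius `r`, where `r = s` or `r = 1`. -/
def IsArc (s r : ℝ) (I : Set ℂ) : Prop :=
  (r = s ∨ r = 1) ∧ I ⊆ Metric.sphere 0 r ∧ IsConnected I ∧
    ∃ U : Set ℂ, IsOpen U ∧ I = U ∩ boundary s

/-- The angles in `(-π, π]` of the points of a subset `I` of the circle of radius `r`. -/
def angles (r : ℝ) (I : Set ℂ) : Set ℝ :=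
  {θ | θ ∈ Set.Ioc (-Real.pi) Real.pi ∧ pt r θ ∈ I}

/-- The proportion of the circle of radius `r` that is occupied by `I` (the number `λ`). -/
def proportion (r : ℝ) (I : Set ℂ) : ℝ :=
  (MeasureTheory.volume (angles r I)).toReal / (2 * Real.pi)

/-- `‖g‖_{L^1(I)} = (1 / (2πλ)) ∫_I |g(r e^{iθ})| dθ`, where `I` lies on the circle of radius `r`
and `λ` is its proportion. -/
def l1Norm (s r : ℝ) (I : Set ℂ) (g : ℂ → ℂ) : ℝ :=
  1 / (2 * Real.pi * proportion r I) * ∫ θ in angles r I, ‖trace s r g θ‖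

/-- `q_0 = -log s`. -/
def q0 (s : ℝ) : ℝ := -Real.log s

/-- The constant
`C_s = inf_{|t| ≤ π} (1 / (2 q_0)) ∑_{j ∈ ℤ} 1 / (1 + cosh ((π / q_0) (t + 2 π j)))`. -/
def Cs (s : ℝ) : ℝ :=
  ⨅ t : Set.Icc (-Real.pi) Real.pi, 1 / (2 * q0 s) *
    ∑' j : ℤ, 1 / (1 + Real.cosh (Real.pi / q0 s * ((t : ℝ) + 2 * Real.pi * (j : ℝ))))

end HardyAnnulus

end

/-! In the coordinate `z = exp w` the annulus becomes the strip `-q0 < Re w < 0` and its functions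
become `2πi`-periodic. The estimate (1) rests on three facts.

First, the unit ball bounds only radial limits, and these must be turned into interior bounds. For
`j ≥ 1` the derivative `f^{(j)}` is the derivative of a function that is Lipschitz up to the
boundary of the strip. Such a function is differentiable almost everywhere along each boundary line,
and there its complex derivative has a radial limit (`tendsto_deriv_of_hasDerivAt`). Hence
almost-everywhere bounds on these limits give Lipschitz bounds along the lines, and the maximum
principle for difference quotients carries them inside (`norm_deriv_le_of_radial_limits`). The
outcome is `|z f^{(j)}(z)| ≤ 1` for `1 ≤ j ≤ k`.

Second, a Lipschitz function with `L^1` norm at most `e^{-l}` on an arc is of size `e^{-l/2}` on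
that arc. If the boundary supremum `μ` exceeds `e^{-l/4}`, a two-constants theorem
(`exists_two_constants`) gives `|f| ≤ μ exp(-c l dist)`, up to constants, where `dist` is the
distance to the boundary of the strip.

Third, a `k`-th radial finite difference with step `d = A/l` bounds a boundary value by interior
values at depth at least `d` and by `d^k sup |f^{(k)}|` (`norm_le_of_interior_decay`). For `A` large
the interior values contribute at most `μ/2`, so `μ ≤ μ/2 + O(l^{-k})`, which is the claim.

For (2) constant functions suffice. For (3) the functions `z^{-N}`, normalized in the Hardy-Sobolev
norm, are small on `𝕋` and larger by the factor `s^{-N}` on `s𝕋`; the normalization costs a factor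
of order `N^k`, and `|log ‖f‖₁|` grows like `N |log s|`. -/

namespace HardyAnnulus

section

open Set Filter MeasureTheory

/-! ### Fatou-type theorem on a strip and boundary control of a derivative -/

/-- The maximum principle for bounded analytic functions on a vertical strip. -/
theorem norm_le_of_verticalStrip {a b C : ℝ} (hab : a < b) {g : ℂ → ℂ}
    (hd : DifferentiableOn ℂ g (Complex.re ⁻¹' Ioo a b))
    (hc : ContinuousOn g (Complex.re ⁻¹' Icc a b))
    (hM : ∃ M : ℝ, ∀ w : ℂ, a < w.re → w.re < b → ‖g w‖ ≤ M)
    (ha : ∀ w : ℂ, w.re = a → ‖g w‖ ≤ C) (hb : ∀ w : ℂ, w.re = b → ‖g w‖ ≤ C)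
    {w : ℂ} (hwa : a ≤ w.re) (hwb : w.re ≤ b) : ‖g w‖ ≤ C := by
  obtain ⟨M, hM⟩ := hM
  refine PhragmenLindelof.vertical_strip (a := a) (b := b) ⟨hd, ?_⟩ ?_ ha hb hwa hwb
  · rw [Complex.closure_preimage_re, closure_Ioo hab.ne]
    exact hc
  · refine ⟨0, div_pos Real.pi_pos (sub_pos.2 hab), 0, ?_⟩
    refine Asymptotics.IsBigO.of_bound M ?_
    refine (eventually_inf_principal.2 (Eventually.of_forall fun w hw => ?_))
    simpa using hM w hw.1 hw.2

theorem isOpen_re_preimage_Ioo (a b : ℝ) : IsOpen (Complex.re ⁻¹' Ioo a b) :=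
  isOpen_Ioo.preimage Complex.continuous_re

/-- Near a boundary point at which `u` is `o(|w|)` along the boundary, a Lipschitz analytic
function on a strip is `o(|w|)` inside the strip, up to a factor that tends to `1`. -/
theorem exists_norm_le_mul_exp {q L : ℝ} (hq : 0 < q) {u : ℂ → ℂ} (hu : Continuous u)
    (hd : DifferentiableOn ℂ u (Complex.re ⁻¹' Ioo (-q) 0)) (hL0 : 0 ≤ L)
    (hL : ∀ w, ‖u w‖ ≤ L * ‖w‖) {ε δ : ℝ} (hε : 0 < ε) (hδ : 0 < δ)
    (hb : ∀ w : ℂ, w.re = 0 → |w.im| < δ → ‖u w‖ ≤ ε * ‖w‖) :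
    ∃ K : ℝ, 0 ≤ K ∧ ∀ w : ℂ, -q ≤ w.re → w.re ≤ 0 →
      ‖u w‖ ≤ ε * ‖w‖ * Real.exp (K * (-w.re * (w.re + 2 * q) + w.im ^ 2)) := by
  set d : ℝ := min (δ ^ 2) (q ^ 2) with hddef
  have hd0 : 0 < d := lt_min (by positivity) (by positivity)
  -- Chosen so that `L exp(-K d) ≤ ε`. The damping exponent is at least `K d` where only the bound
  -- `L` is known: it is `K (q² + y²)` on the left line and `K y²` with `|y| ≥ δ` on the right one.
  set K : ℝ := L / ε / d with hK
  have hK0 : 0 ≤ K := by positivity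
  have hKe : ∀ t, d ≤ t → L * Real.exp (-(K * t)) ≤ ε := by
    intro t ht
    have h1 : L / ε ≤ Real.exp (K * t) := by
      have h2 : L / ε ≤ K * t := by
        calc L / ε = K * d := by rw [hK]; field_simp
          _ ≤ K * t := by gcongr
      linarith [Real.add_one_le_exp (K * t)]
    rw [Real.exp_neg, ← div_eq_mul_inv, div_le_iff₀ (Real.exp_pos _)]
    rw [div_le_iff₀ hε] at h1
    linarith
  refine ⟨K, hK0, fun w hw1 hw2 => ?_⟩
  have hexp : ∀ w : ℂ, ‖Complex.exp (K * (w ^ 2 + 2 * q * w))‖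
      = Real.exp (-(K * (-w.re * (w.re + 2 * q) + w.im ^ 2))) := by
    intro w
    rw [Complex.norm_exp]
    congr 1
    simp [pow_two]
    ring
  have hne : ∀ {w : ℂ}, w.re ≤ 0 → ∀ {η : ℝ}, 0 < η → w - η ≠ 0 := by
    intro w hw η hη h
    have := congrArg Complex.re h
    simp at this
    linarith
  have hnorm : ∀ {w : ℂ}, w.re ≤ 0 → ∀ {η : ℝ}, 0 < η → ‖w‖ ≤ ‖w - η‖ := by
    intro w hw η hη
    rw [← sq_le_sq₀ (norm_nonneg _) (norm_nonneg _), ← Complex.normSq_eq_norm_sq,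
      ← Complex.normSq_eq_norm_sq, Complex.normSq_apply, Complex.normSq_apply]
    simp
    nlinarith
  have key : ∀ η : ℝ, 0 < η →
      ‖u w‖ ≤ ε * ‖w - η‖ * Real.exp (K * (-w.re * (w.re + 2 * q) + w.im ^ 2)) := by
    intro η hη
    -- The pole is moved from `0` to `η > 0`, outside the strip; this only increases the modulus of
    -- the denominator, so the bounds for `u w / w` persist. At the end `η → 0`.
    set g : ℂ → ℂ := fun w => u w / (w - η) * Complex.exp (K * (w ^ 2 + 2 * q * w)) with hg
    have hgn : ∀ w : ℂ, w.re ≤ 0 → ‖u w / (w - η)‖ ≤ L := by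
      intro w hw
      rw [norm_div, div_le_iff₀ (norm_pos_iff.2 (hne hw hη))]
      exact (hL w).trans (by gcongr; exact hnorm hw hη)
    have hfac : ∀ w : ℂ, -q ≤ w.re → w.re ≤ 0 →
        q * -w.re + w.im ^ 2 ≤ -w.re * (w.re + 2 * q) + w.im ^ 2 := by
      intro w h1 h2
      nlinarith
    have hle : ‖g w‖ ≤ ε := by
      refine norm_le_of_verticalStrip (a := -q) (b := 0) (by linarith) ?_ ?_ ⟨L, ?_⟩ ?_ ?_ hw1 hw2
      · refine DifferentiableOn.mul (hd.div (by fun_prop) fun w hw => hne hw.2.le hη) (by fun_prop)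
      · refine ContinuousOn.mul (hu.continuousOn.div (by fun_prop) fun w hw => hne hw.2 hη)
          (by fun_prop)
      · intro w h1 h2
        rw [hg]
        simp only [norm_mul]
        rw [hexp]
        calc _ ≤ L * 1 := by
              gcongr
              · exact hgn w h2.le
              · rw [Real.exp_le_one_iff, neg_nonpos]
                have := hfac w h1.le h2.le
                have h3 : 0 ≤ q * -w.re := mul_nonneg hq.le (by linarith)
                exact mul_nonneg hK0 (by nlinarith)
          _ = L := mul_one L
      · intro w h1
        simp only [hg, norm_mul]
        rw [hexp]
        refine (mul_le_mul_of_nonneg_right (hgn w (by linarith)) (Real.exp_nonneg _)).trans (hKe _ ?_)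
        refine (min_le_right _ _).trans ?_
        rw [h1]; nlinarith [sq_nonneg w.im]
      · intro w h1
        simp only [hg, norm_mul]
        rw [hexp]
        by_cases h2 : |w.im| < δ
        · have h3 : ‖u w / (w - η)‖ ≤ ε := by
            rw [norm_div, div_le_iff₀ (norm_pos_iff.2 (hne h1.le hη))]
            exact (hb w h1 h2).trans (by gcongr; exact hnorm h1.le hη)
          calc _ ≤ ε * 1 := by
                gcongr
                rw [Real.exp_le_one_iff, neg_nonpos, h1]
                refine mul_nonneg hK0 ?_
                simp; positivity
            _ = ε := mul_one _
        · refine (mul_le_mul_of_nonneg_right (hgn w (by linarith)) (Real.exp_nonneg _)).trans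
            (hKe _ ?_)
          refine (min_le_left _ _).trans ?_
          rw [h1, ← sq_abs w.im]
          have : δ ^ 2 ≤ |w.im| ^ 2 := by gcongr; exact not_lt.1 h2
          simpa using this
    have h4 : 0 < ‖w - η‖ := norm_pos_iff.2 (hne hw2 hη)
    simp only [hg, norm_mul, norm_div] at hle
    rw [hexp, Real.exp_neg, div_mul_eq_mul_div, div_le_iff₀ h4, ← div_eq_mul_inv,
      div_le_iff₀ (Real.exp_pos _)] at hle
    exact hle
  have ht : Tendsto (fun η : ℝ => ε * ‖w - η‖ * Real.exp (K * (-w.re * (w.re + 2 * q) + w.im ^ 2)))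
      (𝓝[>] 0) (𝓝 (ε * ‖w - (0 : ℝ)‖ * Real.exp (K * (-w.re * (w.re + 2 * q) + w.im ^ 2)))) := by
    refine Tendsto.mono_left ?_ nhdsWithin_le_nhds
    have : Continuous (fun η : ℝ =>
      ε * ‖w - η‖ * Real.exp (K * (-w.re * (w.re + 2 * q) + w.im ^ 2))) := by fun_prop
    exact this.tendsto 0
  have := ge_of_tendsto ht (eventually_nhdsWithin_of_forall fun η hη => key η hη)
  simpa using this

/-- A Fatou theorem: if a Lipschitz function that is analytic on the strip `-q < Re w < 0` is
differentiable along the boundary line at `0`, then its derivative has a radial limit there. -/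
theorem tendsto_deriv_of_hasDerivAt_zero {q : ℝ} (hq : 0 < q) {h : ℂ → ℂ} {K : NNReal}
    (hL : LipschitzWith K h) (hd : DifferentiableOn ℂ h (Complex.re ⁻¹' Ioo (-q) 0)) {c : ℂ}
    (hc : HasDerivAt (fun y : ℝ => h (y * Complex.I)) (c * Complex.I) 0) :
    Tendsto (fun x : ℝ => deriv h x) (𝓝[<] 0) (𝓝 c) := by
  set u : ℂ → ℂ := fun w => h w - h 0 - c * w with hu
  have hucont : Continuous u := by have := hL.continuous; fun_prop
  have hud : DifferentiableOn ℂ u (Complex.re ⁻¹' Ioo (-q) 0) :=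
    (hd.sub (by fun_prop)).sub (by fun_prop)
  have huL : ∀ w, ‖u w‖ ≤ (K + ‖c‖) * ‖w‖ := by
    intro w
    calc ‖u w‖ ≤ ‖h w - h 0‖ + ‖c * w‖ := norm_sub_le _ _
      _ ≤ K * ‖w - 0‖ + ‖c‖ * ‖w‖ := by
          rw [norm_mul]; gcongr; exact hL.norm_sub_le w 0
      _ = _ := by rw [sub_zero]; ring
  rw [Metric.tendsto_nhds]
  intro ε' hε'
  -- The `9` comes from Cauchy's estimate on the disc of radius `|x|/2` about `x`: there `‖w‖ ≤
  -- 3|x|/2` and the exponential factor is at most `3`, so `‖u‖ ≤ (9/2) ε |x|`, which is divided by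
  -- `|x|/2`.
  obtain ⟨ε, hε, hεε'⟩ : ∃ ε : ℝ, 0 < ε ∧ 9 * ε < ε' := ⟨ε' / 10, by positivity, by linarith⟩
  obtain ⟨δ, hδ, hδb⟩ : ∃ δ : ℝ, 0 < δ ∧ ∀ w : ℂ, w.re = 0 → |w.im| < δ → ‖u w‖ ≤ ε * ‖w‖ := by
    have h1 := (hasDerivAt_iff_isLittleO.1 hc).def hε
    obtain ⟨δ, hδ, h2⟩ := Metric.eventually_nhds_iff.1 h1
    refine ⟨δ, hδ, fun w hw1 hw2 => ?_⟩
    have h3 := h2 (y := w.im) (by simpa [Real.dist_eq] using hw2)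
    have h4 : (w.im : ℂ) * Complex.I = w := by
      apply Complex.ext <;> simp [hw1]
    have h5 : ‖w‖ = ‖w.im‖ := by rw [← h4]; simp
    rw [h5]
    simp only [sub_zero, Complex.ofReal_zero, zero_mul, h4, Complex.real_smul] at h3
    have h6 : u w = h w - h 0 - w.im * (c * Complex.I) := by
      linear_combination c * h4
    rw [h6]
    exact h3
  obtain ⟨k, hk0, hk⟩ := exists_norm_le_mul_exp hq hucont hud (by positivity) huL hε hδ hδb
  have hsmall : ∀ᶠ x : ℝ in 𝓝[<] 0, k * (3 * q * |x| + x ^ 2) < 1 / 2 := by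
    have : Tendsto (fun x : ℝ => k * (3 * q * |x| + x ^ 2)) (𝓝[<] 0)
        (𝓝 (k * (3 * q * |0| + 0 ^ 2))) := by
      refine Tendsto.mono_left ?_ nhdsWithin_le_nhds
      have h6 : Continuous (fun x : ℝ => k * (3 * q * |x| + x ^ 2)) := by fun_prop
      exact h6.tendsto 0
    refine this.eventually (gt_mem_nhds ?_)
    norm_num
  have hq2 : ∀ᶠ x : ℝ in 𝓝[<] 0, -(q / 2) < x :=
    (lt_mem_nhds (by linarith : -(q / 2) < 0)).filter_mono nhdsWithin_le_nhds
  filter_upwards [hsmall, hq2, self_mem_nhdsWithin] with x hx1 hx2 hx3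
  have hx3 : x < 0 := hx3
  have hdx : deriv u x = deriv h x - c := by
    have hdh : DifferentiableAt ℂ h x :=
      (hd x ⟨by simp; linarith, by simpa using hx3⟩).differentiableAt
        ((isOpen_re_preimage_Ioo _ _).mem_nhds ⟨by simp; linarith, by simpa using hx3⟩)
    exact ((hdh.hasDerivAt.sub_const _).sub
      (by simpa using (hasDerivAt_id (x : ℂ)).const_mul c)).deriv
  have hball : ∀ w ∈ Metric.closedBall (x : ℂ) (-x / 2), 3 / 2 * x ≤ w.re ∧ w.re ≤ x / 2 ∧
      |w.im| ≤ -x / 2 ∧ ‖w‖ ≤ -(3 / 2 * x) := by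
    intro w hw
    rw [Metric.mem_closedBall, dist_eq_norm] at hw
    have h1 := abs_le.1 ((Complex.abs_re_le_norm _).trans hw)
    have h2 := (Complex.abs_im_le_norm _).trans hw
    simp at h1 h2
    refine ⟨by linarith, by linarith, by linarith, ?_⟩
    calc ‖w‖ = ‖(w - x) + x‖ := by simp
      _ ≤ ‖w - x‖ + ‖(x : ℂ)‖ := norm_add_le _ _
      _ ≤ -x / 2 + -x := by gcongr; simp [abs_of_neg hx3]
      _ = _ := by ring
  have hb : ‖deriv u x‖ ≤ (ε * (-(3 / 2 * x)) * 3) / (-x / 2) := by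
    refine Complex.norm_deriv_le_of_forall_mem_sphere_norm_le (by linarith) ?_ ?_
    · refine ⟨hud.mono fun w hw => ?_, hucont.continuousOn⟩
      obtain ⟨h1, h2, -, -⟩ := hball w (Metric.ball_subset_closedBall hw)
      exact ⟨by linarith, by linarith⟩
    · intro w hw
      obtain ⟨h1, h2, h3, h4⟩ := hball w (Metric.sphere_subset_closedBall hw)
      refine (hk w (by linarith) (by linarith)).trans ?_
      have h5 : Real.exp (k * (-w.re * (w.re + 2 * q) + w.im ^ 2)) ≤ 3 := by
        have h6 : w.im ^ 2 ≤ x ^ 2 := by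
          rw [← sq_abs w.im]; nlinarith [abs_nonneg w.im]
        have h7 : -w.re * (w.re + 2 * q) + w.im ^ 2 ≤ 3 * q * |x| + x ^ 2 := by
          rw [abs_of_neg hx3]; nlinarith
        have h8 : k * (-w.re * (w.re + 2 * q) + w.im ^ 2) ≤ 1 := by
          nlinarith [mul_le_mul_of_nonneg_left h7 hk0]
        exact (Real.exp_le_exp.2 h8).trans (by linarith [Real.exp_one_lt_d9])
      have h9 : 0 ≤ ε * -(3 / 2 * x) := mul_nonneg hε.le (by linarith)
      gcongr
  rw [dist_eq_norm, ← hdx]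
  refine hb.trans_lt ?_
  rw [div_lt_iff₀ (by linarith)]
  nlinarith

theorem tendsto_deriv_of_hasDerivAt {q : ℝ} (hq : 0 < q) {h : ℂ → ℂ} {K : NNReal}
    (hL : LipschitzWith K h) (hd : DifferentiableOn ℂ h (Complex.re ⁻¹' Ioo (-q) 0)) {c : ℂ} {y : ℝ}
    (hc : HasDerivAt (fun y : ℝ => h (y * Complex.I)) (c * Complex.I) y) :
    Tendsto (fun x : ℝ => deriv h (x + y * Complex.I)) (𝓝[<] 0) (𝓝 c) := by
  have h1 : LipschitzWith K (fun w => h (w + y * Complex.I)) := by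
    exact LipschitzWith.of_dist_le_mul fun a b => by
      simpa using hL.dist_le_mul (a + y * Complex.I) (b + y * Complex.I)
  have h2 : DifferentiableOn ℂ (fun w => h (w + y * Complex.I)) (Complex.re ⁻¹' Ioo (-q) 0) :=
    hd.comp (by fun_prop) fun w hw => by simpa using hw
  have h3 : HasDerivAt (fun t : ℝ => h (t * Complex.I + y * Complex.I)) (c * Complex.I) 0 := by
    have := HasDerivAt.comp_add_const (x := 0) (a := y)
      (f := fun y : ℝ => h (y * Complex.I)) (f' := c * Complex.I) (by simpa using hc)
    simpa [add_mul] using this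
  have h4 := tendsto_deriv_of_hasDerivAt_zero hq h1 h2 h3
  simpa [deriv_comp_add_const] using h4

/-- If the radial limits of `h'` on the line `Re w = 0` are bounded by `B`, then `h` is
`B`-Lipschitz along this line. -/
theorem norm_sub_le_of_radial_limits {q B : ℝ} (hq : 0 < q) {h : ℂ → ℂ} {K : NNReal}
    (hL : LipschitzWith K h) (hd : DifferentiableOn ℂ h (Complex.re ⁻¹' Ioo (-q) 0))
    (hB : ∀ᵐ y : ℝ, ∀ c : ℂ, Tendsto (fun x : ℝ => deriv h (x + y * Complex.I)) (𝓝[<] 0) (𝓝 c) →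
      ‖c‖ ≤ B) (y₁ y₂ : ℝ) :
    ‖h (y₂ * Complex.I) - h (y₁ * Complex.I)‖ ≤ B * |y₂ - y₁| := by
  have hLy : LipschitzWith K (fun y : ℝ => h (y * Complex.I)) := by
    refine LipschitzWith.of_dist_le_mul fun a b => ?_
    have h1 := hL.dist_le_mul (a * Complex.I) (b * Complex.I)
    have h2 : dist (a * Complex.I) (b * Complex.I) = dist a b := by
      rw [dist_eq_norm, ← sub_mul, ← Complex.ofReal_sub, norm_mul, Complex.norm_I, mul_one,
        Complex.norm_real, dist_eq_norm]
    rwa [h2] at h1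
  set F : ℝ → ℂ := fun y => deriv (fun y : ℝ => h (y * Complex.I)) y
  -- Rademacher's theorem on the line: a Lipschitz function is differentiable almost everywhere. The
  -- factor `-I` converts the derivative in `y` into the complex derivative.
  have hlim : ∀ᵐ y : ℝ, Tendsto (fun x : ℝ => deriv h (x + y * Complex.I)) (𝓝[<] 0)
      (𝓝 (F y * -Complex.I)) := by
    filter_upwards [hLy.ae_differentiableAt_real] with y hy
    refine tendsto_deriv_of_hasDerivAt hq hL hd ?_
    have : F y * -Complex.I * Complex.I = F y := by
      rw [mul_assoc]; simp
    rw [this]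
    exact hy.hasDerivAt
  have hFB : ∀ᵐ y : ℝ, ‖F y‖ ≤ B := by
    filter_upwards [hlim, hB] with y h1 h2
    simpa using h2 _ h1
  have hmem : ∀ᶠ x : ℝ in 𝓝[<] 0, -q < x ∧ x < 0 := by
    filter_upwards [(lt_mem_nhds (by linarith : -q < 0)).filter_mono nhdsWithin_le_nhds,
      self_mem_nhdsWithin] with x h1 h2 using ⟨h1, h2⟩
  have hat : ∀ x : ℝ, -q < x → x < 0 → ∀ y : ℝ, DifferentiableAt ℂ h (x + y * Complex.I) := by
    intro x h1 h2 y
    have : (x + y * Complex.I : ℂ) ∈ Complex.re ⁻¹' Ioo (-q) 0 := by simpa using ⟨h1, h2⟩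
    exact (hd _ this).differentiableAt ((isOpen_re_preimage_Ioo _ _).mem_nhds this)
  have hcont : ∀ x : ℝ, -q < x → x < 0 →
      Continuous (fun y : ℝ => Complex.I * deriv h (x + y * Complex.I)) := by
    intro x h1 h2
    have h3 : ContinuousOn (deriv h) (Complex.re ⁻¹' Ioo (-q) 0) :=
      (hd.deriv (isOpen_re_preimage_Ioo _ _)).continuousOn
    refine continuous_const.mul (h3.comp_continuous (by fun_prop) fun y => ?_)
    simpa using ⟨h1, h2⟩
  have hbd : ∀ z, ‖deriv h z‖ ≤ K := fun z => norm_deriv_le_of_lipschitz hL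
  -- The fundamental theorem of calculus is used on the lines `Re w = x < 0`, where `h` is analytic;
  -- dominated convergence, with the Lipschitz constant as majorant, moves it to the boundary.
  have hint : Tendsto (fun x : ℝ => ∫ y in y₁..y₂, Complex.I * deriv h (x + y * Complex.I)) (𝓝[<] 0)
      (𝓝 (∫ y in y₁..y₂, Complex.I * (F y * -Complex.I))) := by
    refine intervalIntegral.tendsto_integral_filter_of_dominated_convergence (fun _ => (K : ℝ))
      ?_ ?_ ?_ ?_
    · filter_upwards [hmem] with x hx
      exact (hcont x hx.1 hx.2).aestronglyMeasurable
    · refine Eventually.of_forall fun x => Eventually.of_forall fun y _ => ?_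
      simpa using hbd _
    · simp
    · filter_upwards [hlim] with y hy _
      exact hy.const_mul _
  have heq : ∀ᶠ x : ℝ in 𝓝[<] 0, ∫ y in y₁..y₂, Complex.I * deriv h (x + y * Complex.I)
      = h (x + y₂ * Complex.I) - h (x + y₁ * Complex.I) := by
    filter_upwards [hmem] with x hx
    refine intervalIntegral.integral_eq_sub_of_hasDerivAt
      (f := fun y : ℝ => h (x + y * Complex.I)) (fun y _ => ?_)
      ((hcont x hx.1 hx.2).intervalIntegrable _ _)
    have h1 : HasDerivAt (fun y : ℝ => (x + y * Complex.I : ℂ)) Complex.I y := by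
      simpa using ((Complex.ofRealCLM.hasDerivAt (x := y)).mul_const Complex.I).const_add (x : ℂ)
    have := (hat x hx.1 hx.2 y).hasDerivAt.comp y h1
    rw [mul_comm]
    exact this
  have hlim2 : Tendsto (fun x : ℝ => h (x + y₂ * Complex.I) - h (x + y₁ * Complex.I)) (𝓝[<] 0)
      (𝓝 (h (y₂ * Complex.I) - h (y₁ * Complex.I))) := by
    refine Tendsto.mono_left ?_ nhdsWithin_le_nhds
    have : Continuous (fun x : ℝ => h (x + y₂ * Complex.I) - h (x + y₁ * Complex.I)) := by
      have := hL.continuous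
      fun_prop
    simpa using this.tendsto 0
  have h5 := tendsto_nhds_unique (hlim2.congr' (heq.mono fun x hx => hx.symm)) hint
  rw [h5]
  refine intervalIntegral.norm_integral_le_of_norm_le_const_ae ?_
  filter_upwards [hFB] with y hy _
  simpa using hy

/-- A Lipschitz function on the strip `-q ≤ Re w ≤ 0`, analytic inside, has a derivative bounded
by `B` as soon as the radial limits of the derivative on both lines are bounded by `B`. -/
theorem norm_deriv_le_of_radial_limits {q B : ℝ} (hq : 0 < q) {h : ℂ → ℂ} {K : NNReal}
    (hL : LipschitzWith K h) (hd : DifferentiableOn ℂ h (Complex.re ⁻¹' Ioo (-q) 0))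
    (hB₁ : ∀ᵐ y : ℝ, ∀ c : ℂ, Tendsto (fun x : ℝ => deriv h (x + y * Complex.I)) (𝓝[<] 0) (𝓝 c) →
      ‖c‖ ≤ B)
    (hB₂ : ∀ᵐ y : ℝ, ∀ c : ℂ,
      Tendsto (fun x : ℝ => deriv h (x + y * Complex.I)) (𝓝[>] (-q)) (𝓝 c) → ‖c‖ ≤ B)
    {w : ℂ} (hw : w ∈ Complex.re ⁻¹' Ioo (-q) 0) : ‖deriv h w‖ ≤ B := by
  have hright := norm_sub_le_of_radial_limits hq hL hd hB₁
  have hleft : ∀ y₁ y₂ : ℝ,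
      ‖h (-q + y₂ * Complex.I) - h (-q + y₁ * Complex.I)‖ ≤ B * |y₂ - y₁| := by
    -- The half-turn `w ↦ -q - w` exchanges the two lines and reverses the sign of `y`.
    have h1 : LipschitzWith K (fun w => h (-q - w)) := by
      exact LipschitzWith.of_dist_le_mul fun a b => by
        have h3 := hL.dist_le_mul (-q - a) (-q - b)
        rwa [dist_sub_left] at h3
    have h2 : DifferentiableOn ℂ (fun w => h (-q - w)) (Complex.re ⁻¹' Ioo (-q) 0) := by
      refine hd.comp (by fun_prop) fun w hw => ?_
      simp only [mem_preimage, mem_Ioo] at hw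
      simp
      constructor <;> linarith
    have hneg : ∀ᵐ y : ℝ, ∀ c : ℂ,
        Tendsto (fun x : ℝ => deriv h (x + (-y : ℝ) * Complex.I)) (𝓝[>] (-q)) (𝓝 c) → ‖c‖ ≤ B :=
      (Measure.measurePreserving_neg (volume : Measure ℝ)).quasiMeasurePreserving.ae hB₂
    have h3 := norm_sub_le_of_radial_limits (B := B) hq h1 h2 (by
      filter_upwards [hneg] with y hy c hc
      have h4 : Tendsto (fun x : ℝ => -q - x) (𝓝[>] (-q)) (𝓝[<] 0) := by
        refine tendsto_nhdsWithin_iff.2 ⟨Tendsto.mono_left ?_ nhdsWithin_le_nhds, ?_⟩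
        · have : Continuous fun x : ℝ => -q - x := by fun_prop
          simpa using this.tendsto (-q)
        · filter_upwards [self_mem_nhdsWithin] with x hx
          have : -q < x := hx
          simp; linarith
      have h5 := hc.comp h4
      rw [← norm_neg]
      refine hy (-c) ?_
      refine h5.neg.congr fun x => ?_
      simp only [Function.comp]
      rw [deriv_comp_const_sub, neg_neg]
      congr 1
      push_cast
      ring)
    intro y₁ y₂
    have h6 := h3 (-y₁) (-y₂)
    have h7 : |(-y₂) - (-y₁)| = |y₂ - y₁| := by rw [abs_sub_comm]; ring_nf
    rw [h7] at h6
    simpa using h6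
  -- Unlike `h'`, the difference `h (w + iα) - h w` is continuous up to the boundary, so the maximum
  -- principle applies to it; dividing by `α → 0` then bounds `h'`.
  have hquot : ∀ α : ℝ, ‖h (w + α * Complex.I) - h w‖ ≤ B * |α| := by
    intro α
    have hc := hL.continuous
    refine norm_le_of_verticalStrip (a := -q) (b := 0) (by linarith)
      (g := fun w => h (w + α * Complex.I) - h w) ?_ (by fun_prop) ⟨K * |α|, ?_⟩ ?_ ?_
      hw.1.le hw.2.le
    · exact (hd.comp (by fun_prop) fun w hw => by simpa using hw).sub hd
    · intro w _ _
      simpa using hL.norm_sub_le (w + α * Complex.I) w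
    · intro w hw
      have h1 : w = -q + w.im * Complex.I := by apply Complex.ext <;> simp [hw]
      have := hleft w.im (w.im + α)
      have h2 : (-q + ((w.im + α : ℝ) : ℂ) * Complex.I) = w + α * Complex.I := by
        conv_rhs => rw [h1]
        push_cast; ring
      rw [h2, ← h1] at this
      simpa using this
    · intro w hw
      have h1 : w = w.im * Complex.I := by apply Complex.ext <;> simp [hw]
      have := hright w.im (w.im + α)
      have h2 : (((w.im + α : ℝ) : ℂ) * Complex.I) = w + α * Complex.I := by
        conv_rhs => rw [h1]
        push_cast; ring
      rw [h2, ← h1] at this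
      simpa using this
  have hdw : HasDerivAt h (deriv h w) w :=
    ((hd w hw).differentiableAt ((isOpen_re_preimage_Ioo _ _).mem_nhds hw)).hasDerivAt
  have hline : HasDerivAt (fun α : ℝ => h (w + α * Complex.I)) (deriv h w * Complex.I) 0 := by
    have h1 : HasDerivAt (fun y : ℝ => (w + y * Complex.I : ℂ)) Complex.I 0 := by
      simpa using ((Complex.ofRealCLM.hasDerivAt (x := 0)).mul_const Complex.I).const_add w
    refine HasDerivAt.comp (0 : ℝ) ?_ h1
    simpa using hdw
  have hB0 : 0 ≤ B := by simpa using (norm_nonneg _).trans (hquot 1)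
  have := hline.le_of_lip' (C := B) hB0 (Eventually.of_forall fun α => by
    simpa using hquot α)
  simpa using this

/-! ### Two-constants theorem on a strip -/

/-- An analytic function on the strip whose real part is at most `1`, is nonpositive on the boundary
away from a short interval around `0`, and is bounded below by a positive constant on a part of the
midline. -/
theorem exists_barrier {q δ : ℝ} (hq : 0 < q) (hδ : 0 < δ) :
    ∃ c : ℝ, 0 < c ∧ ∃ P : ℂ → ℂ, ContinuousOn P (Complex.re ⁻¹' Icc (-q) 0) ∧
      DifferentiableOn ℂ P (Complex.re ⁻¹' Ioo (-q) 0) ∧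
      (∀ w : ℂ, -q ≤ w.re → w.re ≤ 0 → (P w).re ≤ 1) ∧
      (∀ w : ℂ, w.re = 0 → δ ≤ |w.im| → (P w).re ≤ 0) ∧
      (∀ w : ℂ, w.re = -q → (P w).re ≤ 0) ∧
      (∀ w : ℂ, w.re = -(q / 2) → |w.im| ≤ Real.pi → c ≤ (P w).re) := by
  have hpi := Real.pi_pos
  -- Conformal map of the strip onto the upper half-plane: the right line goes to the positive axis,
  -- the left one to the negative axis, and `0` to `1`. The barrier is a Poisson kernel with pole at
  -- `1 - iη`, lowered by a constant and rescaled.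
  set ζ : ℂ → ℂ := fun w => Complex.exp (-(Real.pi / q : ℝ) * w * Complex.I) with hζ
  have hζre : ∀ w, (ζ w).re = Real.exp (Real.pi / q * w.im) * Real.cos (Real.pi / q * w.re) := by
    intro w; simp [hζ, Complex.exp_re]
  have hζim : ∀ w, (ζ w).im = Real.exp (Real.pi / q * w.im) * Real.sin (-(Real.pi / q * w.re)) := by
    intro w; simp [hζ, Complex.exp_im]
  have hζim0 : ∀ w : ℂ, -q ≤ w.re → w.re ≤ 0 → 0 ≤ (ζ w).im := by
    intro w h1 h2
    rw [hζim]
    refine mul_nonneg (Real.exp_nonneg _) (Real.sin_nonneg_of_nonneg_of_le_pi ?_ ?_)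
    · have : 0 ≤ Real.pi / q * -w.re := mul_nonneg (by positivity) (by linarith)
      linarith
    · calc -(Real.pi / q * w.re) = Real.pi / q * -w.re := by ring
        _ ≤ Real.pi / q * q := by gcongr; linarith
        _ = Real.pi := by field_simp
  -- Lower bound for `|ζ - 1|` on the boundary away from the interval of half-length `δ`. There the
  -- kernel is at most `η / ρ²`, the constant that is subtracted.
  set ρ : ℝ := 1 - Real.exp (-(Real.pi / q * δ)) with hρ
  have hρ0 : 0 < ρ := by
    have : Real.exp (-(Real.pi / q * δ)) < 1 := by
      rw [Real.exp_lt_one_iff]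
      have : 0 < Real.pi / q * δ := by positivity
      linarith
    linarith
  have hρ1 : ρ ≤ 1 := by linarith [Real.exp_pos (-(Real.pi / q * δ))]
  set T : ℝ := Real.exp (Real.pi / q * Real.pi) with hT
  have hT0 : 0 < T := Real.exp_pos _
  set κ : ℝ := T⁻¹ / (1 + (T + 1) ^ 2) with hκ
  have hκ0 : 0 < κ := by positivity
  -- `κ` bounds the kernel from below on the relevant part of the midline; this `η` makes the
  -- subtracted constant `η / ρ²` at most `κ / 2`, and half of the lower bound survives.
  set η : ℝ := min 1 (ρ ^ 2 * κ / 2) with hη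
  have hη0 : 0 < η := lt_min one_pos (by positivity)
  set D : ℂ → ℂ := fun w => ζ w - 1 + η * Complex.I with hD
  have hDre : ∀ w, (D w).re = (ζ w).re - 1 := by intro w; simp [hD]
  have hDim : ∀ w, (D w).im = (ζ w).im + η := by intro w; simp [hD]
  have hDne : ∀ w : ℂ, -q ≤ w.re → w.re ≤ 0 → D w ≠ 0 := by
    intro w h1 h2 h
    have := hDim w
    rw [h] at this
    simp at this
    linarith [hζim0 w h1 h2]
  have hPre : ∀ w, (Complex.I / D w).re = (D w).im / ((D w).re ^ 2 + (D w).im ^ 2) := by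
    intro w
    rw [Complex.div_re, Complex.normSq_apply]
    simp [pow_two]
  have hre : ∀ w, ((η : ℂ) * (Complex.I / D w - (η / ρ ^ 2 : ℝ))).re
      = η * ((D w).im / ((D w).re ^ 2 + (D w).im ^ 2) - η / ρ ^ 2) := by
    intro w
    rw [Complex.re_ofReal_mul, Complex.sub_re, Complex.ofReal_re, hPre]
  have hDd : Differentiable ℂ D := by fun_prop
  have hneg : ∀ w, (ζ w).im = 0 → ρ ≤ |(ζ w).re - 1| →
      ((η : ℂ) * (Complex.I / D w - (η / ρ ^ 2 : ℝ))).re ≤ 0 := by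
    intro w h1 h2
    rw [hre, hDim, hDre, h1, zero_add]
    refine mul_nonpos_of_nonneg_of_nonpos hη0.le (sub_nonpos.2 ?_)
    gcongr
    rw [← sq_abs ((ζ w).re - 1)]
    nlinarith [sq_nonneg η]
  refine ⟨η * (κ / 2), by positivity, fun w => η * (Complex.I / D w - (η / ρ ^ 2 : ℝ)), ?_, ?_, ?_, ?_,
    ?_, ?_⟩
  · exact continuousOn_const.mul ((continuousOn_const.div hDd.continuous.continuousOn
      fun w hw => hDne w hw.1 hw.2).sub continuousOn_const)
  · exact ((((differentiableOn_const _).div hDd.differentiableOn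
      fun w hw => hDne w hw.1.le hw.2.le)).sub (differentiableOn_const _)).const_mul _
  · intro w h1 h2
    rw [hre]
    have h3 := hζim0 w h1 h2
    have h4 : (D w).im / ((D w).re ^ 2 + (D w).im ^ 2) ≤ 1 / η := by
      have h5 : η ≤ (D w).im := by rw [hDim]; linarith
      rw [div_le_div_iff₀ (by nlinarith [sq_nonneg (D w).re]) hη0]
      nlinarith [sq_nonneg (D w).re]
    calc η * ((D w).im / ((D w).re ^ 2 + (D w).im ^ 2) - η / ρ ^ 2) ≤ η * (1 / η) := by
          gcongr
          have : 0 ≤ η / ρ ^ 2 := by positivity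
          linarith
      _ = 1 := by field_simp
  · intro w h1 h2
    refine hneg w (by rw [hζim, h1]; simp) ?_
    rw [hζre, h1]
    simp only [mul_zero, Real.cos_zero, mul_one]
    rcases le_abs.1 h2 with h3 | h3
    · refine le_trans ?_ (le_abs_self _)
      have h4 : Real.exp (Real.pi / q * δ) ≤ Real.exp (Real.pi / q * w.im) := by
        apply Real.exp_le_exp.2; gcongr
      have h5 := Real.add_one_le_exp (Real.pi / q * δ)
      have h6 := Real.add_one_le_exp (-(Real.pi / q * δ))
      linarith
    · refine le_trans ?_ (neg_le_abs _)
      have h4 : Real.exp (Real.pi / q * w.im) ≤ Real.exp (-(Real.pi / q * δ)) := by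
        apply Real.exp_le_exp.2
        have : Real.pi / q * δ ≤ Real.pi / q * -w.im := by gcongr
        linarith
      linarith
  · intro w h1
    have h2 : Real.pi / q * -q = -Real.pi := by field_simp
    refine hneg w (by rw [hζim, h1, h2]; simp) ?_
    rw [hζre, h1, h2]
    refine le_trans ?_ (neg_le_abs _)
    simp
    linarith [Real.exp_pos (Real.pi / q * w.im)]
  · intro w h1 h2
    have h2 := abs_le.1 h2
    rw [hre]
    have h3 : Real.pi / q * -(q / 2) = -(Real.pi / 2) := by field_simp
    have hr : (D w).re = -1 := by rw [hDre, hζre, h1, h3]; simp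
    have hi : (D w).im = Real.exp (Real.pi / q * w.im) + η := by
      rw [hDim, hζim, h1, h3]; simp
    rw [hr, hi]
    set E := Real.exp (Real.pi / q * w.im)
    have hE1 : E ≤ T := Real.exp_le_exp.2 (by gcongr; exact h2.2)
    have hE2 : T⁻¹ ≤ E := by
      rw [hT, ← Real.exp_neg]
      refine Real.exp_le_exp.2 ?_
      have : Real.pi / q * -Real.pi ≤ Real.pi / q * w.im := by gcongr; exact h2.1
      linarith
    have hη1 : η ≤ 1 := min_le_left _ _
    have h4 : κ ≤ (E + η) / ((-1) ^ 2 + (E + η) ^ 2) := by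
      have h7 : 0 < E := Real.exp_pos _
      rw [hκ, neg_one_sq]
      gcongr
      linarith
    have h5 : η / ρ ^ 2 ≤ κ / 2 := by
      rw [div_le_iff₀ (by positivity)]
      calc η ≤ ρ ^ 2 * κ / 2 := min_le_right _ _
        _ = _ := by ring
    gcongr
    linarith

/-- The two-constants theorem for a strip. -/
theorem exists_two_constants {q δ : ℝ} (hq : 0 < q) (hδ : 0 < δ) :
    ∃ c : ℝ, 0 < c ∧ ∀ (G : ℂ → ℂ) (y₀ μ Λ : ℝ), Continuous G →
      DifferentiableOn ℂ G (Complex.re ⁻¹' Ioo (-q) 0) →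
      (∃ M : ℝ, ∀ w : ℂ, -q < w.re → w.re < 0 → ‖G w‖ ≤ M) → 0 ≤ μ → 0 ≤ Λ →
      (∀ w : ℂ, w.re = -q → ‖G w‖ ≤ μ) → (∀ w : ℂ, w.re = 0 → ‖G w‖ ≤ μ) →
      (∀ n : ℤ, ∀ y : ℝ, |y - (y₀ + n * (2 * Real.pi))| < δ →
        ‖G (y * Complex.I)‖ ≤ μ * Real.exp (-Λ)) →
      ∀ w : ℂ, -q ≤ w.re → w.re ≤ 0 →
        ‖G w‖ ≤ μ * Real.exp (-(c * Λ * min (-w.re) (w.re + q))) := by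
  obtain ⟨c, hc, P, hPc, hPd, hP1, hP2, hP3, hP4⟩ := exists_barrier hq hδ
  refine ⟨2 * c / q, by positivity, ?_⟩
  intro G y₀ μ Λ hG hGd hM hμ hΛ hl hr hs
  obtain ⟨M, hM⟩ := hM
  have hM0 : ∀ w : ℂ, -q < w.re → w.re < 0 → 0 ≤ M := fun w h1 h2 => (norm_nonneg _).trans (hM w h1 h2)
  have hmid : ∀ w : ℂ, w.re = -(q / 2) → ‖G w‖ ≤ μ * Real.exp (-(c * Λ)) := by
    intro w hw
    -- Small intervals recur with period `2π`, so every height is within `π` of one of their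
    -- centres; this is why the barrier is controlled only for `|Im w| ≤ π`.
    obtain ⟨n, hn⟩ : ∃ n : ℤ, |w.im - (y₀ + n * (2 * Real.pi))| ≤ Real.pi := by
      refine ⟨round ((w.im - y₀) / (2 * Real.pi)), ?_⟩
      have h1 := abs_sub_round ((w.im - y₀) / (2 * Real.pi))
      have h2 : w.im - (y₀ + round ((w.im - y₀) / (2 * Real.pi)) * (2 * Real.pi))
          = ((w.im - y₀) / (2 * Real.pi) - round ((w.im - y₀) / (2 * Real.pi))) * (2 * Real.pi) := by
        field_simp
        ring
      rw [h2, abs_mul, abs_of_pos Real.two_pi_pos]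
      calc _ ≤ 1 / 2 * (2 * Real.pi) := by gcongr
        _ = Real.pi := by ring
    set v : ℂ := ((y₀ + n * (2 * Real.pi) : ℝ) : ℂ) * Complex.I with hv
    have hvre : v.re = 0 := by simp [hv]
    have hvim : v.im = y₀ + n * (2 * Real.pi) := by simp [hv]
    -- The factor `exp(Λ P)` has modulus at most `1` on the boundary outside the small interval, and
    -- at most `exp Λ` on it, where the gain `exp(-Λ)` compensates.
    have hle : ‖G (w - v + v) * Complex.exp (Λ * P (w - v))‖ ≤ μ := by
      refine norm_le_of_verticalStrip (a := -q) (b := 0) (by linarith)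
        (g := fun z => G (z + v) * Complex.exp (Λ * P z)) ?_ ?_ ⟨M * Real.exp Λ, ?_⟩ ?_ ?_
        (by simp [hvre, hw]; linarith) (by simp [hvre, hw]; linarith)
      · refine DifferentiableOn.mul (hGd.comp (by fun_prop) fun z hz => ?_) ?_
        · simpa [hvre] using hz
        · exact (hPd.const_mul _).cexp
      · refine ContinuousOn.mul (by fun_prop) ?_
        exact (continuousOn_const.mul hPc).cexp
      · intro z h1 h2
        have h0 := hM0 z h1 h2
        rw [norm_mul, Complex.norm_exp, Complex.re_ofReal_mul]
        gcongr
        · exact hM _ (by simpa [hvre] using h1) (by simpa [hvre] using h2)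
        · exact mul_le_of_le_one_right hΛ (hP1 z h1.le h2.le)
      · intro z h1
        rw [norm_mul, Complex.norm_exp, Complex.re_ofReal_mul]
        calc _ ≤ μ * 1 := by
              gcongr
              · exact hl _ (by simpa [hvre] using h1)
              · exact Real.exp_le_one_iff.2 (mul_nonpos_of_nonneg_of_nonpos hΛ (hP3 z h1))
          _ = μ := mul_one _
      · intro z h1
        rw [norm_mul, Complex.norm_exp, Complex.re_ofReal_mul]
        by_cases h2 : δ ≤ |z.im|
        · calc _ ≤ μ * 1 := by
                gcongr
                · exact hr _ (by simpa [hvre] using h1)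
                · exact Real.exp_le_one_iff.2 (mul_nonpos_of_nonneg_of_nonpos hΛ (hP2 z h1 h2))
            _ = μ := mul_one _
        · have h3 := hs n (z.im + v.im) (by rw [hvim]; simpa using h2)
          have h4 : ((z.im + v.im : ℝ) : ℂ) * Complex.I = z + v := by
            apply Complex.ext <;> simp [h1, hvre]
          rw [h4] at h3
          calc _ ≤ μ * Real.exp (-Λ) * Real.exp (Λ * 1) := by
                gcongr
                exact hP1 z (by linarith) h1.le
            _ = μ := by rw [mul_assoc, ← Real.exp_add]; simp
    rw [sub_add_cancel, norm_mul, Complex.norm_exp, Complex.re_ofReal_mul,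
      ← le_div_iff₀ (Real.exp_pos _), div_eq_mul_inv, ← Real.exp_neg] at hle
    refine hle.trans ?_
    have := hP4 (w - v) (by simp [hvre, hw]) (by simpa [hvim] using hn)
    rw [mul_comm c Λ]
    gcongr
  set a : ℝ := 2 * c / q * Λ with ha
  have ha0 : 0 ≤ a := by positivity
  have haq : a * (q / 2) = c * Λ := by rw [ha]; field_simp
  intro w hw1 hw2
  -- Three lines theorem for a bound that is exponential in `Re w`. It is applied on each half of
  -- the strip, between the midline and a boundary line.
  have key : ∀ (b x₁ x₂ x : ℝ), -q ≤ x₁ → x₂ ≤ 0 → x₁ < x₂ → x₁ ≤ w.re → w.re ≤ x₂ →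
      (∀ z : ℂ, z.re = x₁ → ‖G z‖ ≤ μ * Real.exp (b * (x₁ - x))) →
      (∀ z : ℂ, z.re = x₂ → ‖G z‖ ≤ μ * Real.exp (b * (x₂ - x))) →
      ‖G w‖ ≤ μ * Real.exp (b * (w.re - x)) := by
    intro b x₁ x₂ x h1 h2 h12 hx1 hx2 hb1 hb2
    have hnorm : ∀ z : ℂ, ‖G z * Complex.exp (-b * (z - x))‖
        = ‖G z‖ * Real.exp (-(b * (z.re - x))) := by
      intro z
      rw [norm_mul, Complex.norm_exp]
      simp
    have hC : ∀ z : ℂ, ‖G z‖ ≤ μ * Real.exp (b * (z.re - x)) →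
        ‖G z * Complex.exp (-b * (z - x))‖ ≤ μ := by
      intro z hz
      rw [hnorm, Real.exp_neg, ← div_eq_mul_inv, div_le_iff₀ (Real.exp_pos _)]
      exact hz
    have hle : ‖G w * Complex.exp (-b * (w - x))‖ ≤ μ := by
      refine norm_le_of_verticalStrip (a := x₁) (b := x₂) h12
        (g := fun z => G z * Complex.exp (-b * (z - x))) ?_ (by fun_prop)
        ⟨M * Real.exp (|b| * (|x| + q)), ?_⟩ ?_ ?_ hx1 hx2
      · refine (hGd.mono fun z hz => ⟨by linarith [hz.1], by linarith [hz.2]⟩).mul (by fun_prop)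
      · intro z hz1 hz2
        have h3 : -q < z.re := by linarith
        have h4 : z.re < 0 := by linarith
        have h0 := hM0 z h3 h4
        rw [hnorm]
        gcongr
        · exact hM z h3 h4
        · calc -(b * (z.re - x)) ≤ |b * (z.re - x)| := neg_le_abs _
            _ = |b| * |z.re - x| := abs_mul _ _
            _ ≤ |b| * (|x| + q) := by
              gcongr
              calc |z.re - x| ≤ |z.re| + |x| := abs_sub _ _
                _ ≤ q + |x| := by gcongr; rw [abs_of_neg h4]; linarith
                _ = _ := add_comm _ _
      · intro z hz; exact hC z (by rw [hz]; exact hb1 z hz)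
      · intro z hz; exact hC z (by rw [hz]; exact hb2 z hz)
    rw [hnorm, Real.exp_neg, ← div_eq_mul_inv, div_le_iff₀ (Real.exp_pos _)] at hle
    exact hle
  rcases le_total (-(q / 2)) w.re with h | h
  · rw [min_eq_left (by linarith)]
    have := key a (-(q / 2)) 0 0 (by linarith) le_rfl (by linarith) h hw2
      (fun z hz => by
        have := hmid z hz
        rwa [show a * (-(q / 2) - 0) = -(c * Λ) by linarith])
      (fun z hz => by simpa using hr z hz)
    convert this using 3
    ring
  · rw [min_eq_right (by linarith)]
    have := key (-a) (-q) (-(q / 2)) (-q) le_rfl (by linarith) (by linarith) hw1 h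
      (fun z hz => by simpa using hl z hz)
      (fun z hz => by
        have := hmid z hz
        rwa [show -a * (-(q / 2) - -q) = -(c * Λ) by linarith])
    convert this using 3
    ring

/-! ### Two real-variable estimates: finite differences and small integrals -/

/-- A bound for the value at `0` of a smooth function in terms of its values at `1, …, k` and of its
`k`-th derivative. -/
theorem norm_le_of_finite_differences (k : ℕ) : ∀ (φ : ℕ → ℝ → ℂ) (A M : ℝ),
    (∀ i < k, ∀ t ∈ Icc (0 : ℝ) k, HasDerivAt (φ i) (φ (i + 1) t) t) →
    (∀ t ∈ Icc (0 : ℝ) k, ‖φ k t‖ ≤ M) →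
    (∀ j : ℕ, 1 ≤ j → j ≤ k → ‖φ 0 j‖ ≤ A) → ‖φ 0 0‖ ≤ (2 ^ k - 1) * A + M := by
  induction k with
  | zero =>
    intro φ A M _ hM _
    simpa using hM 0 (by simp)
  | succ k ih =>
    intro φ A M hφ hM hA
    have hsub : ∀ t ∈ Icc (0 : ℝ) k, t ∈ Icc (0 : ℝ) (k + 1 : ℕ) ∧ t + 1 ∈ Icc (0 : ℝ) (k + 1 : ℕ) := by
      intro t ht
      push_cast
      exact ⟨⟨ht.1, by linarith [ht.2]⟩, ⟨by linarith [ht.1], by linarith [ht.2]⟩⟩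
    -- Induction on forward differences: they are at most `2A` at the nodes, and the mean value
    -- inequality bounds the `k`-th derivative of the difference by `M`. The constants obey `1 + 2
    -- (2^k - 1) = 2^(k+1) - 1`.
    have h := ih (fun i t => φ i (t + 1) - φ i t) (2 * A) M ?_ ?_ ?_
    · have h0 := hA 1 le_rfl (by omega)
      simp only [zero_add] at h
      calc ‖φ 0 0‖ = ‖φ 0 1 - (φ 0 1 - φ 0 0)‖ := by congr 1; ring
        _ ≤ ‖φ 0 1‖ + ‖φ 0 1 - φ 0 0‖ := norm_sub_le _ _
        _ ≤ A + ((2 ^ k - 1) * (2 * A) + M) := by gcongr; simpa using h0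
        _ = _ := by ring
    · intro i hi t ht
      exact ((hφ i (by omega) _ (hsub t ht).2).comp_add_const t 1).sub
        (hφ i (by omega) _ (hsub t ht).1)
    · intro t ht
      have h1 : ∀ x ∈ Icc t (t + 1), x ∈ Icc (0 : ℝ) (k + 1 : ℕ) := fun x hx =>
        ⟨(hsub t ht).1.1.trans hx.1, hx.2.trans (hsub t ht).2.2⟩
      have := norm_image_sub_le_of_norm_deriv_le_segment' (C := M)
        (fun x hx => (hφ k (by omega) x (h1 x hx)).hasDerivWithinAt)
        (fun x hx => hM x (h1 x (Ico_subset_Icc_self hx))) (t + 1) (by simp)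
      simpa using this
    · intro j hj1 hj2
      have h1 := hA j hj1 (by omega)
      have h2 := hA (j + 1) (by omega) (by omega)
      push_cast at h2
      calc _ ≤ _ := norm_sub_le _ _
        _ ≤ 2 * A := by linarith

/-- A nonnegative `1`-Lipschitz function with a small integral is small. -/
theorem le_of_integral_le {φ : ℝ → ℝ} {a b A t x : ℝ} (hφ : LipschitzWith 1 φ) (h0 : ∀ x, 0 ≤ φ x)
    (hA : ∫ y in a..b, φ y ≤ A) (ht : 0 < t) (htab : 2 * t ≤ b - a) (hx : x ∈ Icc a b) :
    φ x ≤ A / t + t := by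
  -- On a window of length `t` containing `x` one has `φ ≥ φ x - t`. Since `2t ≤ b - a`, such a
  -- window fits to the right or to the left of `x`.
  have key : ∀ c, a ≤ c → c + t ≤ b → x ∈ Icc c (c + t) → φ x ≤ A / t + t := by
    intro c h1 h2 h3
    have hint : ∀ u v, IntervalIntegrable φ volume u v := fun u v =>
      hφ.continuous.intervalIntegrable u v
    have h4 : ∫ y in c..(c + t), (φ x - t) ≤ ∫ y in c..(c + t), φ y := by
      refine intervalIntegral.integral_mono_on (by linarith) (by simp) (hint _ _) fun y hy => ?_
      have h5 := hφ.dist_le_mul x y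
      simp only [Real.dist_eq, NNReal.coe_one, one_mul] at h5
      have h6 : |x - y| ≤ t := abs_le.2 ⟨by linarith [hy.2, h3.1], by linarith [hy.1, h3.2]⟩
      linarith [le_abs_self (φ x - φ y)]
    have h7 : ∫ y in c..(c + t), φ y ≤ ∫ y in a..b, φ y :=
      intervalIntegral.integral_mono_interval h1 (by linarith) h2 (Eventually.of_forall h0)
        (hint _ _)
    simp at h4
    have h8 : t * (φ x - t) ≤ A := by linarith
    have h9 : φ x - t ≤ A / t := by rw [le_div_iff₀ ht]; linarith
    linarith
  rcases le_total (x + t) b with h | h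
  · exact key x hx.1 h ⟨le_rfl, by linarith⟩
  · exact key (x - t) (by linarith) (by linarith [hx.2]) ⟨by linarith, by linarith⟩

/-! ### Angles and arcs on a circle -/

theorem continuous_pt (r : ℝ) : Continuous (pt r) := by unfold pt; fun_prop

theorem norm_pt {r : ℝ} (hr : 0 ≤ r) (θ : ℝ) : ‖pt r θ‖ = r := by
  simp [pt, Complex.norm_exp_ofReal_mul_I, abs_of_nonneg hr]

theorem pt_add_two_pi (r θ : ℝ) : pt r (θ + 2 * Real.pi) = pt r θ := by
  simp only [pt]
  push_cast
  rw [add_mul, Complex.exp_periodic]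

/-- An arc through the angle `π` is split by the window `(-π, π]`; periodicity allows a window that
begins outside the arc. -/
theorem setIntegral_angles_eq {r : ℝ} {I : Set ℂ} (hI : MeasurableSet I) {φ : ℝ → ℝ}
    (hp : Function.Periodic φ (2 * Real.pi)) (a : ℝ) :
    ∫ θ in angles r I, φ θ = ∫ θ in pt r ⁻¹' I ∩ Ioc a (a + 2 * Real.pi), φ θ := by
  have hS : MeasurableSet (pt r ⁻¹' I) := (continuous_pt r).measurable hI
  have hper : Function.Periodic ((pt r ⁻¹' I).indicator φ) (2 * Real.pi) := by
    intro θ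
    have h : θ + 2 * Real.pi ∈ pt r ⁻¹' I ↔ θ ∈ pt r ⁻¹' I := by
      rw [mem_preimage, pt_add_two_pi, mem_preimage]
    by_cases h' : θ ∈ pt r ⁻¹' I
    · rw [indicator_of_mem (h.2 h'), indicator_of_mem h', hp]
    · rw [indicator_of_notMem (mt h.1 h'), indicator_of_notMem h']
  have h1 : ∀ a, ∫ θ in a..(a + 2 * Real.pi), (pt r ⁻¹' I).indicator φ θ
      = ∫ θ in pt r ⁻¹' I ∩ Ioc a (a + 2 * Real.pi), φ θ := by
    intro a
    rw [intervalIntegral.integral_of_le (by linarith [Real.pi_pos]), integral_indicator hS,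
      Measure.restrict_restrict hS]
  rw [← h1, hper.intervalIntegral_add_eq a (-Real.pi), h1]
  congr 2
  ext θ
  simp only [angles, mem_ofPred_eq, mem_inter_iff, mem_preimage]
  rw [and_comm, show -Real.pi + 2 * Real.pi = Real.pi by ring]

/-- An arc that occupies the proportion `lam` of its circle contains all points whose angles lie in
some interval of length `2 π lam`. -/
theorem IsArc.exists_interval {s r lam : ℝ} {I : Set ℂ} (hI : IsArc s r I) (hr : 0 < r)
    (hlam : 0 < lam) (hprop : proportion r I = lam) :
    ∃ y₀ : ℝ, (∀ y, |y - y₀| < Real.pi * lam → pt r y ∈ I) ∧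
      ∀ φ : ℝ → ℝ, Continuous φ → (∀ x, 0 ≤ φ x) → Function.Periodic φ (2 * Real.pi) →
        ∫ θ in (y₀ - Real.pi * lam)..(y₀ + Real.pi * lam), φ θ ≤ ∫ θ in angles r I, φ θ := by
  obtain ⟨-, hsph, hconn, U, hU, hUI⟩ := hI
  have hpi := Real.pi_pos
  have hmeas : MeasurableSet I := by
    rw [hUI]
    exact hU.measurableSet.inter (Metric.isClosed_sphere.union Metric.isClosed_sphere).measurableSet
  have hS : MeasurableSet (pt r ⁻¹' I) := (continuous_pt r).measurable hmeas
  suffices h : ∃ a y₀ : ℝ, Ioo (y₀ - Real.pi * lam) (y₀ + Real.pi * lam)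
      ⊆ pt r ⁻¹' I ∩ Ioc a (a + 2 * Real.pi) by
    obtain ⟨a, y₀, h⟩ := h
    refine ⟨y₀, fun y hy => ?_, fun φ hφ h0 hp => ?_⟩
    · rw [abs_lt] at hy
      exact (h ⟨by linarith, by linarith⟩).1
    · rw [setIntegral_angles_eq hmeas hp a, intervalIntegral.integral_of_le
        (by nlinarith [mul_pos hpi hlam]), integral_Ioc_eq_integral_Ioo]
      refine setIntegral_mono_set ?_ (Eventually.of_forall h0) (LE.le.eventuallyLE h)
      exact ((hφ.integrableOn_Icc (a := a) (b := a + 2 * Real.pi)).mono_set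
        (inter_subset_right.trans Ioc_subset_Icc_self))
  have hvol : ∀ a, volume.real (pt r ⁻¹' I ∩ Ioc a (a + 2 * Real.pi)) = 2 * Real.pi * lam := by
    intro a
    have h1 := setIntegral_angles_eq (r := r) hmeas (φ := fun _ => 1) (fun _ => rfl) a
    simp only [setIntegral_const, smul_eq_mul, mul_one] at h1
    rw [← h1, ← hprop, proportion, Measure.real]
    field_simp
  by_cases hall : ∀ θ, pt r θ ∈ I
  · have hS1 : pt r ⁻¹' I = univ := eq_univ_of_forall hall
    have h2 := hvol (-Real.pi)
    rw [hS1, univ_inter, Real.volume_real_Ioc_of_le (by linarith)] at h2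
    have h3 : lam = 1 := by
      have : 2 * Real.pi * (lam - 1) = 0 := by linarith
      rcases mul_eq_zero.1 this with h | h <;> linarith
    refine ⟨-Real.pi, 0, ?_⟩
    rw [hS1, univ_inter, h3]
    intro x hx
    exact ⟨by linarith [hx.1], by linarith [hx.2]⟩
  · push Not at hall
    obtain ⟨θ₁, hθ₁⟩ := hall
    set J := pt r ⁻¹' I ∩ Ioc θ₁ (θ₁ + 2 * Real.pi) with hJ
    -- The circle is cut at `θ₁ ∉ I`: rotation by `e` puts the cut on the negative axis, so `ψ` is a
    -- continuous angle on `I` and its image `J` is an interval. `J` has measure `2πλ`, hence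
    -- contains the open interval of that length about its midpoint.
    set e : ℂ := Complex.exp (-((θ₁ + Real.pi : ℝ) : ℂ) * Complex.I) with he
    have hpte : ∀ θ, pt r θ * e = r * Complex.exp (((θ - (θ₁ + Real.pi) : ℝ) : ℂ) * Complex.I) := by
      intro θ
      rw [pt, he, mul_assoc, ← Complex.exp_add]
      congr 2
      push_cast; ring
    set ψ : ℂ → ℝ := fun z => θ₁ + Real.pi + (z * e).arg with hψ
    have hne : ‖e‖ = 1 := by
      rw [he, ← Complex.ofReal_neg]; exact Complex.norm_exp_ofReal_mul_I _
    have hptψ : ∀ z ∈ I, pt r (ψ z) = z := by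
      intro z hz
      have h1 : ‖z‖ = r := by simpa using hsph hz
      have h2 : pt r (ψ z) * e = z * e := by
        rw [hpte, hψ]
        simp only [add_sub_cancel_left]
        have := Complex.norm_mul_exp_arg_mul_I (z * e)
        rwa [norm_mul, hne, mul_one, h1] at this
      exact mul_right_cancel₀ (Complex.exp_ne_zero _) h2
    have hJI : ψ '' I = J := by
      ext θ
      constructor
      · rintro ⟨z, hz, rfl⟩
        refine ⟨by simpa [hptψ z hz] using hz, ?_, ?_⟩
        · have := Complex.neg_pi_lt_arg (z * e)
          simp only [hψ]; linarith
        · have := Complex.arg_le_pi (z * e)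
          simp only [hψ]; linarith
      · rintro ⟨h1, h2, h3⟩
        refine ⟨pt r θ, h1, ?_⟩
        simp only [hψ, hpte]
        rw [Complex.exp_mul_I, Complex.arg_mul_cos_add_sin_mul_I hr
          ⟨by linarith, by linarith⟩]
        ring
    have hcont : ContinuousOn ψ I := by
      intro z hz
      refine ContinuousAt.continuousWithinAt ?_
      have hsl : z * e ∈ Complex.slitPlane := by
        rw [Complex.mem_slitPlane_iff_arg]
        constructor
        · intro h
          have h1 := hptψ z hz
          simp only [hψ, h] at h1
          rw [show θ₁ + Real.pi + Real.pi = θ₁ + 2 * Real.pi by ring, pt_add_two_pi] at h1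
          exact hθ₁ (h1 ▸ hz)
        · have h1 : ‖z‖ = r := by simpa using hsph hz
          have : ‖z * e‖ ≠ 0 := by rw [norm_mul, hne, h1]; simp [hr.ne']
          exact norm_ne_zero_iff.1 this
      exact continuousAt_const.add
        ((Complex.continuousAt_arg hsl).comp (f := fun z => z * e) (by fun_prop))
    have hJc : IsConnected J := hJI ▸ hconn.image ψ hcont
    have hba : BddAbove J := ⟨θ₁ + 2 * Real.pi, fun x hx => hx.2.2⟩
    have hbb : BddBelow J := ⟨θ₁, fun x hx => hx.2.1.le⟩
    have hsub : J ⊆ Icc (sInf J) (sSup J) := subset_Icc_csInf_csSup hbb hba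
    have hlen : 2 * Real.pi * lam ≤ sSup J - sInf J := by
      rw [← hvol θ₁]
      have hJne : (sInf J) ≤ sSup J := by
        obtain ⟨z, hz⟩ := hconn.nonempty
        have : ψ z ∈ J := hJI ▸ mem_image_of_mem ψ hz
        exact (hsub this).1.trans (hsub this).2
      rw [← Real.volume_real_Icc_of_le hJne]
      exact measureReal_mono hsub (by simp)
    refine ⟨θ₁, (sInf J + sSup J) / 2, fun x hx => ?_⟩
    refine hJc.Ioo_csInf_csSup_subset hbb hba ⟨?_, ?_⟩
    · linarith [hx.1]
    · linarith [hx.2]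

/-! ### The annulus in logarithmic coordinates -/

theorem isOpen_annulus (s : ℝ) : IsOpen (annulus s) :=
  (isOpen_lt continuous_const continuous_norm).inter (isOpen_lt continuous_norm continuous_const)

theorem q0_pos {s : ℝ} (hs0 : 0 < s) (hs1 : s < 1) : 0 < q0 s :=
  neg_pos.2 (Real.log_neg hs0 hs1)

theorem exp_neg_q0 {s : ℝ} (hs0 : 0 < s) : Real.exp (-q0 s) = s := by
  rw [q0, neg_neg, Real.exp_log hs0]

theorem exp_mem_annulus {s : ℝ} (hs0 : 0 < s) {w : ℂ} (hw : w ∈ Complex.re ⁻¹' Ioo (-q0 s) 0) :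
    Complex.exp w ∈ annulus s := by
  rw [annulus, mem_ofPred_eq, Complex.norm_exp]
  exact ⟨by simpa [exp_neg_q0 hs0] using Real.exp_lt_exp.2 hw.1, Real.exp_lt_one_iff.2 hw.2⟩

theorem trace_add_two_pi (s ρ : ℝ) (g : ℂ → ℂ) (θ : ℝ) :
    trace s ρ g (θ + 2 * Real.pi) = trace s ρ g θ := by
  simp only [trace, pt_add_two_pi]

theorem neBot_nhdsWithin_Ioo {a b x : ℝ} (hab : a < b) (hx : x = a ∨ x = b) :
    (𝓝[Ioo a b] x).NeBot := by
  refine mem_closure_iff_nhdsWithin_neBot.1 ?_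
  rw [closure_Ioo hab.ne]
  rcases hx with rfl | rfl
  exacts [left_mem_Icc.2 hab.le, right_mem_Icc.2 hab.le]

/-- The trace of a function on the annulus, computed in logarithmic coordinates. -/
theorem trace_eq_of_tendsto {s : ℝ} (hs0 : 0 < s) (hs1 : s < 1) {g : ℂ → ℂ} {x₀ y : ℝ}
    (hx₀ : x₀ = -q0 s ∨ x₀ = 0) {c : ℂ}
    (hc : Tendsto (fun x : ℝ => g (Complex.exp (x + y * Complex.I))) (𝓝[Ioo (-q0 s) 0] x₀) (𝓝 c)) :
    trace s (Real.exp x₀) g y = c := by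
  have hρ : Real.exp x₀ = s ∨ Real.exp x₀ = 1 := by
    rcases hx₀ with rfl | rfl
    · exact Or.inl (exp_neg_q0 hs0)
    · exact Or.inr Real.exp_zero
  have := neBot_nhdsWithin_Ioo hs1 hρ
  refine Tendsto.limUnder_eq ?_
  have hlog : Tendsto Real.log (𝓝[Ioo s 1] (Real.exp x₀)) (𝓝[Ioo (-q0 s) 0] x₀) := by
    refine tendsto_nhdsWithin_iff.2 ⟨?_, ?_⟩
    · have := (Real.continuousAt_log (Real.exp_pos x₀).ne').tendsto
      rw [Real.log_exp] at this
      exact this.mono_left nhdsWithin_le_nhds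
    · filter_upwards [self_mem_nhdsWithin] with r hr
      refine ⟨?_, Real.log_neg (hs0.trans hr.1) hr.2⟩
      rw [q0, neg_neg]
      exact Real.log_lt_log hs0 hr.1
  refine (hc.comp hlog).congr' ?_
  filter_upwards [self_mem_nhdsWithin] with r hr
  simp only [Function.comp, pt]
  rw [Complex.exp_add, ← Complex.ofReal_exp, Real.exp_log (hs0.trans hr.1)]

/-- The norm sees one period only; the countably many translates by `2πn` spread the bound over the
whole line. -/
theorem ae_norm_trace_le {s ρ : ℝ} {g : ℂ → ℂ} (h : linftyCircle s ρ g ≤ 1) :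
    ∀ᵐ y : ℝ, ‖trace s ρ g y‖ ≤ 1 := by
  have hpi := Real.two_pi_pos
  have h0 : ∀ᵐ y ∂(volume.restrict (Ioc (-Real.pi) Real.pi)), ‖trace s ρ g y‖ ≤ 1 := by
    rw [linftyCircle, eLpNorm_exponent_top] at h
    filter_upwards [ae_le_eLpNormEssSup (f := trace s ρ g)
      (μ := volume.restrict (Ioc (-Real.pi) Real.pi))] with y hy
    have := hy.trans h
    rwa [← ofReal_norm, ENNReal.ofReal_le_one] at this
  rw [ae_restrict_iff' measurableSet_Ioc] at h0
  have h1 : ∀ᵐ y : ℝ, ∀ n : ℤ, y + n * (2 * Real.pi) ∈ Ioc (-Real.pi) Real.pi →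
      ‖trace s ρ g (y + n * (2 * Real.pi))‖ ≤ 1 := by
    rw [ae_all_iff]
    intro n
    exact (measurePreserving_add_right (volume : Measure ℝ)
      (n * (2 * Real.pi))).quasiMeasurePreserving.ae h0
  filter_upwards [h1] with y hy
  have hper : Function.Periodic (trace s ρ g) (2 * Real.pi) := trace_add_two_pi s ρ g
  obtain ⟨n, hn, -⟩ := existsUnique_add_zsmul_mem_Ioc hpi y (-Real.pi)
  have h2 := hy n (by
    rw [zsmul_eq_mul] at hn
    exact ⟨hn.1, by linarith [hn.2]⟩)
  rwa [hper.int_mul n y] at h2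

theorem hasDerivAt_comp_exp {s : ℝ} (hs0 : 0 < s) {g : ℂ → ℂ}
    (hg : DifferentiableOn ℂ g (annulus s)) {w : ℂ} (hw : w ∈ Complex.re ⁻¹' Ioo (-q0 s) 0) :
    HasDerivAt (fun w => g (Complex.exp w)) (Complex.exp w * deriv g (Complex.exp w)) w := by
  have h1 := exp_mem_annulus hs0 hw
  have h2 := ((hg _ h1).differentiableAt ((isOpen_annulus s).mem_nhds h1)).hasDerivAt
  rw [mul_comm]
  exact h2.comp w (Complex.hasDerivAt_exp w)

theorem norm_sub_le_comp_exp {s M : ℝ} (hs0 : 0 < s) {g : ℂ → ℂ}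
    (hg : DifferentiableOn ℂ g (annulus s)) (hM : ∀ z ∈ annulus s, ‖z * deriv g z‖ ≤ M) {w₁ w₂ : ℂ}
    (h₁ : w₁ ∈ Complex.re ⁻¹' Ioo (-q0 s) 0) (h₂ : w₂ ∈ Complex.re ⁻¹' Ioo (-q0 s) 0) :
    ‖g (Complex.exp w₂) - g (Complex.exp w₁)‖ ≤ M * ‖w₂ - w₁‖ := by
  have hconv : Convex ℝ (Complex.re ⁻¹' Ioo (-q0 s) 0) :=
    (convex_Ioo (-q0 s) 0).linear_preimage Complex.reLm
  exact hconv.norm_image_sub_le_of_norm_hasDerivWithin_le (𝕜 := ℂ)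
    (fun w hw => (hasDerivAt_comp_exp hs0 hg hw).hasDerivWithinAt)
    (fun w hw => hM _ (exp_mem_annulus hs0 hw)) h₁ h₂

/-- An analytic function with bounded derivative on the annulus is, in logarithmic coordinates, the
restriction of a Lipschitz function on the plane. -/
theorem exists_lipschitz_extension {s M : ℝ} (hs0 : 0 < s) {g : ℂ → ℂ}
    (hg : DifferentiableOn ℂ g (annulus s)) (hM : ∀ z ∈ annulus s, ‖deriv g z‖ ≤ M) :
    ∃ (K : NNReal) (h : ℂ → ℂ), LipschitzWith K h ∧
      ∀ w ∈ Complex.re ⁻¹' Ioo (-q0 s) 0, h w = g (Complex.exp w) := by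
  have hM' : ∀ z ∈ annulus s, ‖z * deriv g z‖ ≤ M.toNNReal := by
    intro z hz
    rw [norm_mul]
    calc ‖z‖ * ‖deriv g z‖ ≤ 1 * M := by gcongr; exacts [hz.2.le, hM z hz]
      _ ≤ _ := by rw [one_mul]; exact Real.le_coe_toNNReal M
  have h1 : LipschitzOnWith M.toNNReal (fun w => g (Complex.exp w))
      (Complex.re ⁻¹' Ioo (-q0 s) 0) :=
    LipschitzOnWith.of_dist_le_mul fun w₁ h₁ w₂ h₂ => by
      rw [dist_eq_norm, dist_eq_norm]
      exact norm_sub_le_comp_exp hs0 hg hM' h₂ h₁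
  obtain ⟨h, hh, heq⟩ := h1.extend_finite_dimension
  exact ⟨_, h, hh, fun w hw => (heq hw).symm⟩

theorem nhdsWithin_Ioo_eq {q : ℝ} (hq : 0 < q) :
    𝓝[Ioo (-q) 0] (0 : ℝ) = 𝓝[<] 0 ∧ 𝓝[Ioo (-q) 0] (-q) = 𝓝[>] (-q) :=
  ⟨nhdsWithin_Ioo_eq_nhdsLT (by linarith), nhdsWithin_Ioo_eq_nhdsGT (by linarith)⟩

/-- The boundary values of a bounded derivative bound this derivative. -/
theorem norm_mul_deriv_le_one {s M : ℝ} (hs0 : 0 < s) (hs1 : s < 1) {g : ℂ → ℂ}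
    (hg : DifferentiableOn ℂ g (annulus s)) (hM : ∀ z ∈ annulus s, ‖deriv g z‖ ≤ M)
    (h₁ : linftyCircle s s (deriv g) ≤ 1) (h₂ : linftyCircle s 1 (deriv g) ≤ 1) {z : ℂ}
    (hz : z ∈ annulus s) : ‖z * deriv g z‖ ≤ 1 := by
  have hq := q0_pos hs0 hs1
  obtain ⟨K, h, hh, heq⟩ := exists_lipschitz_extension hs0 hg hM
  have hderiv : ∀ w ∈ Complex.re ⁻¹' Ioo (-q0 s) 0,
      HasDerivAt h (Complex.exp w * deriv g (Complex.exp w)) w := fun w hw =>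
    (hasDerivAt_comp_exp hs0 hg hw).congr_of_eventuallyEq
      (eventuallyEq_of_mem ((isOpen_re_preimage_Ioo _ _).mem_nhds hw) heq)
  have hlim : ∀ x₀ y : ℝ, x₀ = -q0 s ∨ x₀ = 0 → linftyCircle s (Real.exp x₀) (deriv g) ≤ 1 →
      ‖trace s (Real.exp x₀) (deriv g) y‖ ≤ 1 → ∀ c : ℂ,
      Tendsto (fun x : ℝ => deriv h (x + y * Complex.I)) (𝓝[Ioo (-q0 s) 0] x₀) (𝓝 c) → ‖c‖ ≤ 1 := by
    intro x₀ y hx₀ hle hy c hc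
    have h3 : Tendsto (fun x : ℝ => Complex.exp (-(x + y * Complex.I))) (𝓝[Ioo (-q0 s) 0] x₀)
        (𝓝 (Complex.exp (-(x₀ + y * Complex.I)))) := by
      have : Continuous fun x : ℝ => Complex.exp (-(x + y * Complex.I)) := by fun_prop
      exact (this.tendsto x₀).mono_left nhdsWithin_le_nhds
    have h4 : trace s (Real.exp x₀) (deriv g) y = Complex.exp (-(x₀ + y * Complex.I)) * c := by
      refine trace_eq_of_tendsto hs0 hs1 hx₀ ((h3.mul hc).congr' ?_)
      filter_upwards [self_mem_nhdsWithin] with x hx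
      rw [(hderiv (x + y * Complex.I) (by simpa using hx)).deriv, ← mul_assoc, ← Complex.exp_add]
      simp
    rw [h4, norm_mul, Complex.norm_exp] at hy
    -- Since `h' = e^w g'(e^w)` and `|e^w| ≤ 1` on the closed strip, a limit of `h'` is no larger
    -- than the corresponding limit of `g'`.
    have h5 : 1 ≤ Real.exp (-(x₀ + y * Complex.I : ℂ)).re := by
      rw [Real.one_le_exp_iff]
      rcases hx₀ with rfl | rfl <;> simp [hq.le]
    nlinarith [norm_nonneg c]
  have hzne : z ≠ 0 := fun h => by
    have := hz.1
    rw [h, norm_zero] at this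
    linarith
  have hw : Complex.log z ∈ Complex.re ⁻¹' Ioo (-q0 s) 0 := by
    have := norm_pos_iff.2 hzne
    rw [mem_preimage, Complex.log_re, q0, neg_neg]
    exact ⟨Real.log_lt_log hs0 hz.1, Real.log_neg this hz.2⟩
  have h6 : ‖deriv h (Complex.log z)‖ ≤ 1 := by
    refine norm_deriv_le_of_radial_limits hq hh
      (fun w hw => (hderiv w hw).differentiableAt.differentiableWithinAt) ?_ ?_ hw
    · filter_upwards [ae_norm_trace_le h₂] with y hy
      rw [← (nhdsWithin_Ioo_eq hq).1]
      exact hlim 0 y (Or.inr rfl) (by simpa using h₂) (by simpa using hy)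
    · filter_upwards [ae_norm_trace_le h₁] with y hy
      rw [← (nhdsWithin_Ioo_eq hq).2]
      exact hlim (-q0 s) y (Or.inl rfl) (by simpa [exp_neg_q0 hs0] using h₁)
        (by simpa [exp_neg_q0 hs0] using hy)
  rwa [(hderiv _ hw).deriv, Complex.exp_log hzne] at h6

/-! ### Functions of the unit ball and the upper estimate -/

variable {k : ℕ} {s : ℝ} {f : ℂ → ℂ}

theorem linftyCircle_add_le_one (hf : f ∈ unitBall k s) {j : ℕ} (hj : j ≤ k) :
    linftyCircle s s (iteratedDeriv j f) + linftyCircle s 1 (iteratedDeriv j f) ≤ 1 :=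
  (Finset.le_sup (f := fun j => linftyCircle s s (iteratedDeriv j f)
    + linftyCircle s 1 (iteratedDeriv j f)) (Finset.mem_range.2 (by omega))).trans hf.2

theorem linftyBoundary_le_one (hf : f ∈ unitBall k s) : linftyBoundary s f ≤ 1 := by
  have := linftyCircle_add_le_one hf (Nat.zero_le k)
  rw [iteratedDeriv_zero] at this
  exact max_le (le_self_add.trans this) (le_add_self.trans this)

theorem norm_mul_iteratedDeriv_le_one (hs0 : 0 < s) (hs1 : s < 1) (hf : f ∈ unitBall k s)
    {j : ℕ} (hj : j < k) {z : ℂ} (hz : z ∈ annulus s) : ‖z * iteratedDeriv (j + 1) f z‖ ≤ 1 := by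
  obtain ⟨hd, -⟩ := hf.1 j hj.le
  obtain ⟨-, M, hM⟩ := hf.1 (j + 1) hj
  have := linftyCircle_add_le_one hf (Nat.succ_le_of_lt hj)
  rw [Nat.succ_eq_add_one] at this
  rw [iteratedDeriv_succ] at *
  exact norm_mul_deriv_le_one hs0 hs1 hd hM (le_self_add.trans this) (le_add_self.trans this) hz

theorem hasDerivAt_iteratedDeriv (hf : f ∈ unitBall k s) {j : ℕ} (hj : j ≤ k) {z : ℂ}
    (hz : z ∈ annulus s) : HasDerivAt (iteratedDeriv j f) (iteratedDeriv (j + 1) f z) z := by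
  rw [iteratedDeriv_succ]
  exact (((hf.1 j hj).1 z hz).differentiableAt ((isOpen_annulus s).mem_nhds hz)).hasDerivAt

/-- A function in the unit ball of the Hardy-Sobolev space, in logarithmic coordinates. -/
theorem exists_strip_function (hs0 : 0 < s) (hs1 : s < 1) (hk : 1 ≤ k) (hf : f ∈ unitBall k s) :
    ∃ h : ℂ → ℂ, Continuous h ∧ DifferentiableOn ℂ h (Complex.re ⁻¹' Ioo (-q0 s) 0) ∧
      (∀ w ∈ Complex.re ⁻¹' Ioo (-q0 s) 0, h w = f (Complex.exp w)) ∧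
      (∃ M : ℝ, ∀ w ∈ Complex.re ⁻¹' Icc (-q0 s) 0, ‖h w‖ ≤ M) ∧
      ∀ x₀ : ℝ, x₀ = -q0 s ∨ x₀ = 0 →
        (∀ y : ℝ, trace s (Real.exp x₀) f y = h (x₀ + y * Complex.I)) ∧
        LipschitzWith 1 (fun y : ℝ => ‖h (x₀ + y * Complex.I)‖) := by
  have hq := q0_pos hs0 hs1
  have hb : ∀ z ∈ annulus s, ‖z * deriv f z‖ ≤ 1 := by
    intro z hz
    have := norm_mul_iteratedDeriv_le_one hs0 hs1 hf hk hz
    rwa [zero_add, iteratedDeriv_one] at this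
  have hd : DifferentiableOn ℂ f (annulus s) := by
    simpa [iteratedDeriv_zero] using (hf.1 0 (Nat.zero_le k)).1
  obtain ⟨M₁, hM₁⟩ := (hf.1 1 hk).2
  obtain ⟨M₀, hM₀⟩ := (hf.1 0 (Nat.zero_le k)).2
  rw [iteratedDeriv_one] at hM₁
  rw [iteratedDeriv_zero] at hM₀
  obtain ⟨K, h, hh, heq⟩ := exists_lipschitz_extension hs0 hd hM₁
  refine ⟨h, hh.continuous, fun w hw => ?_, heq, ⟨M₀, fun w hw => ?_⟩, fun x₀ hx₀ => ?_⟩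
  · exact ((hasDerivAt_comp_exp hs0 hd hw).congr_of_eventuallyEq (eventuallyEq_of_mem
      ((isOpen_re_preimage_Ioo _ _).mem_nhds hw) heq)).differentiableAt.differentiableWithinAt
  · have hcl : Complex.re ⁻¹' Icc (-q0 s) 0 = closure (Complex.re ⁻¹' Ioo (-q0 s) 0) := by
      rw [Complex.closure_preimage_re, closure_Ioo (by linarith)]
    rw [hcl] at hw
    refine closure_minimal (t := {w | ‖h w‖ ≤ M₀}) (fun w hw => ?_)
      (isClosed_le hh.continuous.norm continuous_const) hw
    rw [mem_ofPred_eq, heq w hw]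
    exact hM₀ _ (exp_mem_annulus hs0 hw)
  · have := neBot_nhdsWithin_Ioo (by linarith : -q0 s < 0) hx₀
    have hmem : ∀ (y : ℝ), ∀ x ∈ Ioo (-q0 s) 0,
        (x + y * Complex.I : ℂ) ∈ Complex.re ⁻¹' Ioo (-q0 s) 0 := by
      intro y x hx
      simpa using hx
    have hlim : ∀ y : ℝ, Tendsto (fun x : ℝ => h (x + y * Complex.I)) (𝓝[Ioo (-q0 s) 0] x₀)
        (𝓝 (h (x₀ + y * Complex.I))) := by
      intro y
      have : Continuous fun x : ℝ => h (x + y * Complex.I) := by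
        have := hh.continuous
        fun_prop
      exact (this.tendsto x₀).mono_left nhdsWithin_le_nhds
    refine ⟨fun y => ?_, LipschitzWith.of_dist_le_mul fun y₂ y₁ => ?_⟩
    · refine trace_eq_of_tendsto hs0 hs1 hx₀ ((hlim y).congr' ?_)
      filter_upwards [self_mem_nhdsWithin] with x hx
      exact heq _ (hmem y x hx)
    · have h1 : ‖h (x₀ + y₂ * Complex.I) - h (x₀ + y₁ * Complex.I)‖ ≤ |y₂ - y₁| := by
        refine le_of_tendsto ((hlim y₂).sub (hlim y₁)).norm ?_
        filter_upwards [self_mem_nhdsWithin] with x hx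
        rw [heq _ (hmem y₂ x hx), heq _ (hmem y₁ x hx)]
        refine (norm_sub_le_comp_exp hs0 hd hb (hmem y₁ x hx) (hmem y₂ x hx)).trans ?_
        rw [add_sub_add_left_eq_sub, ← sub_mul, ← Complex.ofReal_sub, norm_mul, Complex.norm_I,
          Complex.norm_real, Real.norm_eq_abs, one_mul, mul_one]
      rw [Real.dist_eq, Real.dist_eq, NNReal.coe_one, one_mul]
      exact (abs_norm_sub_norm_le _ _).trans h1

/-- The two-constants theorem for a strip, with the small arcs on either boundary line. -/
theorem exists_two_constants_of_line {q δ : ℝ} (hq : 0 < q) (hδ : 0 < δ) :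
    ∃ c : ℝ, 0 < c ∧ ∀ (G : ℂ → ℂ) (x₀ y₀ μ Λ : ℝ), x₀ = -q ∨ x₀ = 0 → Continuous G →
      DifferentiableOn ℂ G (Complex.re ⁻¹' Ioo (-q) 0) →
      (∃ M : ℝ, ∀ w ∈ Complex.re ⁻¹' Icc (-q) 0, ‖G w‖ ≤ M) → 0 ≤ μ → 0 ≤ Λ →
      (∀ x : ℝ, x = -q ∨ x = 0 → ∀ y : ℝ, ‖G (x + y * Complex.I)‖ ≤ μ) →
      (∀ n : ℤ, ∀ y : ℝ, |y - (y₀ + n * (2 * Real.pi))| < δ →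
        ‖G (x₀ + y * Complex.I)‖ ≤ μ * Real.exp (-Λ)) →
      ∀ w ∈ Complex.re ⁻¹' Icc (-q) 0,
        ‖G w‖ ≤ μ * Real.exp (-(c * Λ * min (-w.re) (w.re + q))) := by
  obtain ⟨c, hc, H⟩ := exists_two_constants hq hδ
  refine ⟨c, hc, ?_⟩
  rintro G x₀ y₀ μ Λ hx₀ hG hGd ⟨M, hM⟩ hμ hΛ hb hs w hw
  have hb' : ∀ x : ℝ, x = -q ∨ x = 0 → ∀ w : ℂ, w.re = x → ‖G w‖ ≤ μ := by
    intro x hx w hw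
    have := hb x hx w.im
    rwa [← hw, Complex.re_add_im] at this
  rcases hx₀ with rfl | rfl
  · have h1 := H (fun w => G (-q - w)) (-y₀) μ Λ (by fun_prop) ?_ ⟨M, fun w h1 h2 => hM _ ?_⟩ hμ hΛ
      (fun w hw => hb' 0 (Or.inr rfl) _ (by simp [hw]))
      (fun w hw => hb' (-q) (Or.inl rfl) _ (by simp [hw])) ?_ (-q - w) ?_ ?_
    · simp only [sub_sub_cancel] at h1
      convert h1 using 4
      simp only [Complex.sub_re, Complex.neg_re, Complex.ofReal_re]
      rw [min_comm]
      ring_nf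
    · refine hGd.comp (by fun_prop) fun z hz => ?_
      simp only [mem_preimage, mem_Ioo, Complex.sub_re, Complex.neg_re, Complex.ofReal_re] at hz ⊢
      constructor <;> linarith
    · simp only [mem_preimage, mem_Icc, Complex.sub_re, Complex.neg_re, Complex.ofReal_re]
      constructor <;> linarith
    · intro n y hy
      have h2 := hs (-n) (-y) (by
        rw [← abs_neg]
        push_cast
        convert hy using 2
        ring)
      convert h2 using 3
      push_cast; ring
    · simpa using hw.2
    · simpa using hw.1
  · exact H G y₀ μ Λ hG hGd ⟨M, fun w h1 h2 => hM w ⟨h1.le, h2.le⟩⟩ hμ hΛ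
      (hb' _ (Or.inl rfl)) (hb' _ (Or.inr rfl)) (fun n y hy => by simpa using hs n y hy)
      w hw.1 hw.2

/-- Interior decay of `f` and the bound for the `k`-th derivative control `f` on the boundary. -/
theorem norm_le_of_interior_decay (hs0 : 0 < s) (hs1 : s < 1) (hk : 1 ≤ k) (hf : f ∈ unitBall k s)
    {h : ℂ → ℂ} (hh : Continuous h)
    (heq : ∀ w ∈ Complex.re ⁻¹' Ioo (-q0 s) 0, h w = f (Complex.exp w)) {μ a d : ℝ} (hμ : 0 ≤ μ)
    (ha : 0 ≤ a) (hd : 0 < d) (hkd : 4 * (k * d) ≤ 1 - s)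
    (hdec : ∀ w ∈ Complex.re ⁻¹' Ioo (-q0 s) 0,
      ‖h w‖ ≤ μ * Real.exp (-(a * min (-w.re) (w.re + q0 s)))) {x₀ : ℝ}
    (hx₀ : x₀ = -q0 s ∨ x₀ = 0) (θ : ℝ) :
    ‖h (x₀ + θ * Complex.I)‖ ≤ (2 ^ k - 1) * (μ * Real.exp (-(a * d))) + d ^ k / s := by
  obtain ⟨ρ₀, σ, hρ₀, hcase⟩ : ∃ ρ₀ σ : ℝ, ρ₀ = Real.exp x₀ ∧ (ρ₀ = s ∧ σ = 1 ∨ ρ₀ = 1 ∧ σ = -1) := by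
    rcases hx₀ with rfl | rfl
    · exact ⟨s, 1, (exp_neg_q0 hs0).symm, Or.inl ⟨rfl, rfl⟩⟩
    · exact ⟨1, -1, Real.exp_zero.symm, Or.inr ⟨rfl, rfl⟩⟩
  have hσ : |σ| = 1 := by rcases hcase with ⟨-, rfl⟩ | ⟨-, rfl⟩ <;> simp
  have hρ₀0 : 0 < ρ₀ := hρ₀ ▸ Real.exp_pos _
  have hk1 : (1 : ℝ) ≤ k := by exact_mod_cast hk
  have hdk : d ≤ k * d := le_mul_of_one_le_left hd.le hk1
  have hptexp : ∀ ρ : ℝ, 0 < ρ → pt ρ θ = Complex.exp (Real.log ρ + θ * Complex.I) := by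
    intro ρ hρ
    rw [pt, Complex.exp_add, ← Complex.ofReal_exp, Real.exp_log hρ]
  have hlogmem : ∀ ρ : ℝ, s < ρ → ρ < 1 →
      (Real.log ρ + θ * Complex.I : ℂ) ∈ Complex.re ⁻¹' Ioo (-q0 s) 0 := by
    intro ρ h1 h2
    have : -q0 s < Real.log ρ := by
      rw [q0, neg_neg]; exact Real.log_lt_log hs0 h1
    simpa using ⟨this, Real.log_neg (hs0.trans h1) h2⟩
  have hfpt : ∀ ρ : ℝ, s < ρ → ρ < 1 → f (pt ρ θ) = h (Real.log ρ + θ * Complex.I) := by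
    intro ρ h1 h2
    rw [hptexp ρ (hs0.trans h1), heq _ (hlogmem ρ h1 h2)]
  -- The derivatives of `f` are controlled only inside the annulus, so the radial nodes start at
  -- depth `τ` and `τ → 0` at the end. The sign `σ` points inward; `τ` and `k d` are at most `(1 -
  -- s)/4`, which keeps the nodes away from the opposite circle.
  have key : ∀ τ : ℝ, 0 < τ → τ < (1 - s) / 4 →
      ‖h (Real.log (ρ₀ + σ * τ) + θ * Complex.I)‖
        ≤ (2 ^ k - 1) * (μ * Real.exp (-(a * d))) + d ^ k / s := by
    intro τ hτ hτ1
    have hρmem : ∀ t ∈ Icc (0 : ℝ) k, s < ρ₀ + σ * (τ + t * d) ∧ ρ₀ + σ * (τ + t * d) < 1 := by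
      intro t ht
      have h1 : 0 ≤ t * d := mul_nonneg ht.1 hd.le
      have h2 : t * d ≤ k * d := by gcongr; exact ht.2
      rcases hcase with ⟨rfl, rfl⟩ | ⟨rfl, rfl⟩ <;> constructor <;> linarith
    have hann : ∀ t ∈ Icc (0 : ℝ) k, pt (ρ₀ + σ * (τ + t * d)) θ ∈ annulus s := by
      intro t ht
      have h1 := hρmem t ht
      rw [annulus, mem_ofPred_eq, norm_pt (hs0.trans h1.1).le]
      exact h1
    set e : ℂ := σ * d * Complex.exp (θ * Complex.I) with he
    have hen : ‖e‖ = d := by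
      rw [he, norm_mul, norm_mul, Complex.norm_exp_ofReal_mul_I, Complex.norm_real,
        Complex.norm_real, Real.norm_eq_abs, hσ, Real.norm_of_nonneg hd.le]
      ring
    -- `e` is the velocity of the radial path, so each `t`-derivative contributes a factor `e` of
    -- modulus `d`. The loss `1/s` comes from `|z f^{(k)}| ≤ 1` and `|z| > s`.
    have hfd := norm_le_of_finite_differences k
      (fun i t => e ^ i * iteratedDeriv i f (pt (ρ₀ + σ * (τ + t * d)) θ))
      (μ * Real.exp (-(a * d))) (d ^ k / s) ?_ ?_ ?_
    · simp only [pow_zero, one_mul, iteratedDeriv_zero, zero_mul, add_zero] at hfd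
      have h1 := hρmem 0 ⟨le_rfl, by positivity⟩
      simp only [zero_mul, add_zero] at h1
      rwa [hfpt _ h1.1 h1.2] at hfd
    · intro i hi t ht
      have h1 : HasDerivAt (fun t : ℝ => pt (ρ₀ + σ * (τ + t * d)) θ) e t := by
        have h2 : HasDerivAt (fun t : ℝ => ρ₀ + σ * (τ + t * d)) (σ * d) t := by
          simpa using ((((hasDerivAt_id t).mul_const d).const_add τ).const_mul σ).const_add ρ₀
        have h3 := h2.ofReal_comp.mul_const (Complex.exp (θ * Complex.I))
        exact h3.congr_deriv (by rw [he]; push_cast; ring)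
      have h2 := ((hasDerivAt_iteratedDeriv hf hi.le (hann t ht)).comp t h1).const_mul (e ^ i)
      exact h2.congr_deriv (by rw [pow_succ]; ring)
    · intro t ht
      have h1 := hann t ht
      obtain ⟨j, rfl⟩ : ∃ j, k = j + 1 := ⟨k - 1, by omega⟩
      have h2 := norm_mul_iteratedDeriv_le_one hs0 hs1 hf (Nat.lt_succ_self j) h1
      rw [norm_mul] at h2
      rw [norm_mul, norm_pow, hen, div_eq_mul_inv]
      gcongr
      rw [← one_div, le_div_iff₀ hs0]
      calc _ ≤ ‖iteratedDeriv (j + 1) f (pt (ρ₀ + σ * (τ + t * d)) θ)‖ *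
            ‖pt (ρ₀ + σ * (τ + t * d)) θ‖ := by gcongr; exact h1.1.le
        _ ≤ 1 := by rwa [mul_comm]
    · intro j hj1 hj2
      have hj1' : (1 : ℝ) ≤ j := by exact_mod_cast hj1
      have hj2' : (j : ℝ) ≤ k := by exact_mod_cast hj2
      have hjm : (j : ℝ) ∈ Icc (0 : ℝ) k := ⟨by linarith, hj2'⟩
      simp only [pow_zero, one_mul, iteratedDeriv_zero]
      set ρ := ρ₀ + σ * (τ + j * d) with hρ
      obtain ⟨h1, h2⟩ := hρmem j hjm
      have h0 : 0 < ρ := hs0.trans h1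
      have h3 : d ≤ ρ - s ∧ d ≤ 1 - ρ := by
        have h4 : d ≤ j * d := le_mul_of_one_le_left hd.le hj1'
        have h5 : j * d ≤ k * d := by gcongr
        rcases hcase with ⟨h, h'⟩ | ⟨h, h'⟩ <;> rw [hρ, h, h'] <;> constructor <;> linarith
      rw [hfpt ρ h1 h2]
      refine (hdec _ (hlogmem ρ h1 h2)).trans ?_
      gcongr
      refine le_min ?_ ?_
      · have := Real.log_le_sub_one_of_pos h0
        simp; linarith
      · have h4 := Real.log_le_sub_one_of_pos (div_pos hs0 h0)
        rw [Real.log_div hs0.ne' h0.ne'] at h4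
        have h5 : s / ρ ≤ 1 - d := by
          rw [div_le_iff₀ h0]
          nlinarith [h3.1, h2]
        simp [q0]; linarith
  have hlim : Tendsto (fun τ : ℝ => ‖h (Real.log (ρ₀ + σ * τ) + θ * Complex.I)‖) (𝓝[>] 0)
      (𝓝 ‖h (x₀ + θ * Complex.I)‖) := by
    have h1 : ContinuousAt (fun τ : ℝ => ‖h (Real.log (ρ₀ + σ * τ) + θ * Complex.I)‖) 0 := by
      have h2 : ContinuousAt (fun τ : ℝ => Real.log (ρ₀ + σ * τ)) 0 :=
        ContinuousAt.log (by fun_prop) (by simpa using hρ₀0.ne')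
      have h3 : ContinuousAt (fun τ : ℝ => (Real.log (ρ₀ + σ * τ) + θ * Complex.I : ℂ)) 0 :=
        (Complex.continuous_ofReal.continuousAt.comp h2).add continuousAt_const
      exact (hh.continuousAt.comp (f := fun τ : ℝ => (Real.log (ρ₀ + σ * τ) + θ * Complex.I : ℂ))
        h3).norm
    have h2 := h1.tendsto
    rw [mul_zero, add_zero, hρ₀, Real.log_exp] at h2
    rw [hρ₀]
    exact h2.mono_left nhdsWithin_le_nhds
  refine le_of_tendsto hlim ?_
  filter_upwards [self_mem_nhdsWithin,
    (gt_mem_nhds (by linarith : (0 : ℝ) < (1 - s) / 4)).filter_mono nhdsWithin_le_nhds] with τ h1 h2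
  exact key τ h1 h2

theorem l1Norm_nonneg (s r : ℝ) (I : Set ℂ) (g : ℂ → ℂ) : 0 ≤ l1Norm s r I g := by
  unfold l1Norm proportion
  have := Real.pi_pos
  have : 0 ≤ ∫ θ in angles r I, ‖trace s r g θ‖ := integral_nonneg fun _ => norm_nonneg _
  positivity

theorem pow_mul_exp_neg_le {x : ℝ} (hx : 0 < x) (k : ℕ) :
    Real.exp (-(x / 4)) ≤ 4 ^ k * k.factorial / x ^ k := by
  have h := Real.pow_div_factorial_le_exp (x / 4) (by positivity) k
  rw [Real.exp_neg, inv_le_comm₀ (Real.exp_pos _) (by positivity)]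
  refine le_trans (le_of_eq ?_) h
  rw [div_pow, inv_div, div_div]

/-- The estimate for all small values of an upper bound `exp (-l)` of the `L¹` norm. -/
theorem exists_linftyBoundary_le (hs0 : 0 < s) (hs1 : s < 1) (hk : 1 ≤ k) {lam : ℝ}
    (hlam : 0 < lam) (hlam1 : lam ≤ 1) :
    ∃ L C : ℝ, 0 < L ∧ 0 ≤ C ∧ ∀ (r : ℝ) (I : Set ℂ), IsArc s r I → proportion r I = lam →
      ∀ f ∈ unitBall k s, ∀ l : ℝ, L ≤ l → l1Norm s r I f ≤ Real.exp (-l) →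
        linftyBoundary s f ≤ ENNReal.ofReal (C / l ^ k) := by
  have hpi := Real.pi_pos
  have hq := q0_pos hs0 hs1
  set δ : ℝ := Real.pi * lam with hδ
  have hδ0 : 0 < δ := by positivity
  obtain ⟨c, hc, H⟩ := exists_two_constants_of_line hq hδ0
  -- With decay rate `c l / 8` and depth `A / l` the exponent is `2^(k+1)`, large enough for the
  -- finite-difference term to be at most `μ / 2`.
  set A : ℝ := 8 * 2 ^ (k + 1) / c with hA
  have hA0 : 0 < A := by positivity
  -- The three thresholds give, in order, `8 ≤ exp(l/8)`, room for `k` steps of length `A / l`, and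
  -- `exp(-l/2) ≤ δ`.
  set L : ℝ := max 56 (max (4 * (k * A) / (1 - s)) (1 / δ ^ 2)) with hL
  have hL56 : 56 ≤ L := le_max_left _ _
  refine ⟨L, max (4 ^ k * k.factorial) (2 * (A ^ k / s)), by linarith, by positivity, ?_⟩
  intro r I hI hprop f hf l hl hnorm
  have hl0 : 0 < l := by linarith
  obtain ⟨h, hh, hhd, heq, ⟨M, hM⟩, hx⟩ := exists_strip_function hs0 hs1 hk hf
  have h1 : ∃ x₀ : ℝ, (x₀ = -q0 s ∨ x₀ = 0) ∧ r = Real.exp x₀ := by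
    rcases hI.1 with rfl | rfl
    · exact ⟨_, Or.inl rfl, (exp_neg_q0 hs0).symm⟩
    · exact ⟨_, Or.inr rfl, Real.exp_zero.symm⟩
  obtain ⟨x₀, hx₀, rfl⟩ := h1
  obtain ⟨htr, hlip⟩ := hx x₀ hx₀
  obtain ⟨y₀, -, hint⟩ := hI.exists_interval (Real.exp_pos x₀) hlam hprop
  set φ : ℝ → ℝ := fun y => ‖h (x₀ + y * Complex.I)‖ with hφ
  have hφtr : ∀ y, ‖trace s (Real.exp x₀) f y‖ = φ y := fun y => by rw [htr y]
  have hper : Function.Periodic φ (2 * Real.pi) := by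
    intro y
    rw [← hφtr, ← hφtr, trace_add_two_pi]
  have hA1 : ∫ y in (y₀ - δ)..(y₀ + δ), φ y ≤ 2 * Real.pi * lam * Real.exp (-l) := by
    refine (hint φ hlip.continuous (fun _ => norm_nonneg _) hper).trans ?_
    rw [l1Norm, hprop] at hnorm
    simp only [hφtr] at hnorm
    have : 0 < 2 * Real.pi * lam := by positivity
    rwa [one_div, inv_mul_le_iff₀ this] at hnorm
  have hsmall : ∀ n : ℤ, ∀ y : ℝ, |y - (y₀ + n * (2 * Real.pi))| < δ →
      φ y ≤ 8 * Real.exp (-(l / 2)) := by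
    intro n y hy
    have h2 : φ y = φ (y - n * (2 * Real.pi)) := (hper.sub_int_mul_eq n).symm
    have h3 := abs_lt.1 hy
    have ht : Real.exp (-(l / 2)) ≤ δ := by
      have h4 : Real.exp (-(l / 2)) ^ 2 ≤ δ ^ 2 := by
        rw [← Real.exp_nat_mul]
        have h5 : 1 / δ ^ 2 ≤ l := ((le_max_right _ _).trans (le_max_right _ _)).trans hl
        have h6 := Real.add_one_le_exp l
        rw [show ((2 : ℕ) : ℝ) * -(l / 2) = -l by push_cast; ring, Real.exp_neg,
          inv_le_comm₀ (Real.exp_pos _) (by positivity), ← one_div]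
        linarith
      exact (sq_le_sq₀ (Real.exp_nonneg _) hδ0.le).1 h4
    have h7 := le_of_integral_le hlip (fun _ => norm_nonneg _) hA1 (Real.exp_pos (-(l / 2)))
      (by linarith) (x := y - n * (2 * Real.pi)) ⟨by linarith, by linarith⟩
    change φ (y - n * (2 * Real.pi)) ≤ _ at h7
    rw [h2]
    refine h7.trans ?_
    have h8 : Real.exp (-l) = Real.exp (-(l / 2)) * Real.exp (-(l / 2)) := by
      rw [← Real.exp_add]; ring_nf
    have h9 : 2 * Real.pi * lam * Real.exp (-l) / Real.exp (-(l / 2))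
        = 2 * Real.pi * lam * Real.exp (-(l / 2)) := by
      rw [h8]; field_simp
    rw [h9]
    have h10 : 2 * Real.pi * lam ≤ 7 := by nlinarith [Real.pi_lt_d2]
    nlinarith [Real.exp_pos (-(l / 2))]
  set S : Set ℝ := {x | ∃ x' : ℝ, (x' = -q0 s ∨ x' = 0) ∧ ∃ y : ℝ, x = ‖h (x' + y * Complex.I)‖}
    with hS
  have hSb : BddAbove S := by
    refine ⟨M, ?_⟩
    rintro _ ⟨x', hx', y, rfl⟩
    refine hM _ ?_
    rcases hx' with rfl | rfl <;> simp [hq.le]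
  set μ := sSup S with hμ
  have hμle : ∀ x : ℝ, x = -q0 s ∨ x = 0 → ∀ y : ℝ, ‖h (x + y * Complex.I)‖ ≤ μ :=
    fun x hx y => le_csSup hSb ⟨x, hx, y, rfl⟩
  have hSne : S.Nonempty := ⟨_, 0, Or.inr rfl, 0, rfl⟩
  have hμ0 : 0 ≤ μ := (norm_nonneg _).trans (hμle 0 (Or.inr rfl) 0)
  suffices hfin : μ ≤ max (4 ^ k * (k.factorial : ℝ)) (2 * (A ^ k / s)) / l ^ k by
    have hcirc : ∀ x : ℝ, x = -q0 s ∨ x = 0 → linftyCircle s (Real.exp x) f ≤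
        ENNReal.ofReal (max (4 ^ k * (k.factorial : ℝ)) (2 * (A ^ k / s)) / l ^ k) := by
      intro x hx'
      rw [linftyCircle, eLpNorm_exponent_top]
      refine eLpNormEssSup_le_of_ae_bound (Eventually.of_forall fun y => ?_)
      rw [(hx x hx').1 y]
      exact (hμle x hx' y).trans hfin
    refine max_le ?_ ?_
    · simpa [exp_neg_q0 hs0] using hcirc _ (Or.inl rfl)
    · simpa using hcirc _ (Or.inr rfl)
  -- If `μ` is already exponentially small there is nothing to do. Otherwise `8 exp(-l/2) ≤ μ
  -- exp(-l/8)`, so smallness on the arc is relative to `μ`, as the two-constants theorem requires.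
  rcases le_or_gt μ (Real.exp (-(l / 4))) with hcase | hcase
  · refine hcase.trans ((pow_mul_exp_neg_le hl0 k).trans ?_)
    gcongr
    exact le_max_left _ _
  · have hdec := H h x₀ y₀ μ (l / 8) hx₀ hh hhd ⟨M, hM⟩ hμ0 (by positivity) hμle (by
      intro n y hy
      refine (hsmall n y hy).trans ?_
      have h2 : 8 ≤ Real.exp (l / 8) := by
        have := Real.add_one_le_exp (l / 8)
        linarith
      calc 8 * Real.exp (-(l / 2)) ≤ Real.exp (l / 8) * Real.exp (-(l / 2)) := by gcongr
        _ = Real.exp (-(l / 4)) * Real.exp (-(l / 8)) := by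
          rw [← Real.exp_add, ← Real.exp_add]; ring_nf
        _ ≤ μ * Real.exp (-(l / 8)) := by gcongr)
    have hkd : 4 * (k * (A / l)) ≤ 1 - s := by
      have h2 : 4 * (k * A) / (1 - s) ≤ l := ((le_max_left _ _).trans (le_max_right _ _)).trans hl
      rw [div_le_iff₀ (by linarith)] at h2
      rw [← mul_div_assoc, ← mul_div_assoc, div_le_iff₀ hl0]
      linarith
    have hstep : ∀ x ∈ S, x ≤ μ / 2 + (A / l) ^ k / s := by
      rintro _ ⟨x', hx', y, rfl⟩
      refine (norm_le_of_interior_decay hs0 hs1 hk hf hh heq hμ0 (a := c * (l / 8))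
        (by positivity) (div_pos hA0 hl0) hkd
        (fun w hw => hdec w ⟨hw.1.le, hw.2.le⟩) hx' y).trans ?_
      gcongr
      have h2 : c * (l / 8) * (A / l) = 2 ^ (k + 1) := by
        rw [hA]; field_simp
      rw [h2]
      have h3 : Real.exp (-2 ^ (k + 1)) ≤ (2 ^ (k + 1))⁻¹ := by
        rw [Real.exp_neg]
        gcongr
        linarith [Real.add_one_le_exp ((2 : ℝ) ^ (k + 1))]
      have h4 : (0 : ℝ) ≤ 2 ^ k - 1 := sub_nonneg.2 (one_le_pow₀ one_le_two)
      calc (2 ^ k - 1) * (μ * Real.exp (-2 ^ (k + 1))) ≤ 2 ^ k * (μ * (2 ^ (k + 1))⁻¹) := by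
            gcongr
            linarith
        _ = μ / 2 := by rw [pow_succ]; field_simp
    have h5 : μ ≤ μ / 2 + (A / l) ^ k / s := csSup_le hSne hstep
    have h6 : μ ≤ 2 * (A ^ k / s) / l ^ k := by
      calc μ ≤ 2 * ((A / l) ^ k / s) := by linarith
        _ = _ := by rw [div_pow]; field_simp
    refine h6.trans ?_
    gcongr
    exact le_max_right _ _

theorem Cs_nonneg {s : ℝ} (hs0 : 0 < s) (hs1 : s < 1) : 0 ≤ Cs s := by
  refine Real.iInf_nonneg fun t => mul_nonneg ?_ (tsum_nonneg fun j => ?_)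
  · have := q0_pos hs0 hs1
    positivity
  · have := Real.cosh_pos (Real.pi / q0 s * ((t : ℝ) + 2 * Real.pi * (j : ℝ)))
    positivity

/-- The threshold serves to give `‖f‖₁ < 1`, so that the logarithm is negative. Where `|log ‖f‖₁| <
L` the trivial bound `‖f‖_∞ ≤ 1` suffices, at the price of `L^k` in the constant. -/
theorem upper_estimate (hs0 : 0 < s) (hs1 : s < 1) (hk : 1 ≤ k) {lam : ℝ}
    (hlam : 0 < lam) (hlam1 : lam ≤ 1) :
    ∃ C : ℝ, 0 ≤ C ∧ ∀ (r : ℝ) (I : Set ℂ), IsArc s r I → proportion r I = lam →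
      ∀ f ∈ unitBall k s, l1Norm s r I f < Real.exp (-(q0 s / (lam * Cs s))) →
        linftyBoundary s f ≤ ENNReal.ofReal (C / |Real.log (l1Norm s r I f)| ^ k) := by
  obtain ⟨L, C, hL, hC, H⟩ := exists_linftyBoundary_le hs0 hs1 hk hlam hlam1
  refine ⟨max C (L ^ k), le_max_of_le_left hC, fun r I hI hprop f hf hlt => ?_⟩
  set m := l1Norm s r I f with hm
  have hlt1 : m < 1 := hlt.trans_le (by
    rw [Real.exp_le_one_iff, neg_nonpos]
    exact div_nonneg (q0_pos hs0 hs1).le (mul_nonneg hlam.le (Cs_nonneg hs0 hs1)))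
  rcases (l1Norm_nonneg s r I f).eq_or_lt' with h0 | hpos
  -- With zero `L^1` norm the previous estimate holds for every `l ≥ L`; letting `l → ∞` shows that
  -- the boundary norm vanishes.
  · have hlim : Tendsto (fun l : ℝ => ENNReal.ofReal (C / l ^ k)) atTop (𝓝 0) := by
      rw [← ENNReal.ofReal_zero]
      refine ENNReal.tendsto_ofReal ?_
      exact tendsto_const_nhds.div_atTop (tendsto_pow_atTop (by omega))
    have : linftyBoundary s f ≤ 0 := by
      refine ge_of_tendsto hlim ?_
      filter_upwards [eventually_ge_atTop L] with l hl
      exact H r I hI hprop f hf l hl (h0.le.trans (Real.exp_nonneg _))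
    exact this.trans zero_le
  · have hlog : Real.log m < 0 := Real.log_neg hpos hlt1
    rw [abs_of_neg hlog]
    have hneg : 0 < -Real.log m := by linarith
    rcases le_or_gt L (-Real.log m) with h | h
    · refine (H r I hI hprop f hf _ h (by rw [neg_neg, Real.exp_log hpos])).trans ?_
      gcongr
      exact le_max_left _ _
    · refine (linftyBoundary_le_one hf).trans ?_
      rw [ENNReal.one_le_ofReal, one_le_div (by positivity)]
      refine le_trans ?_ (le_max_right _ _)
      gcongr

/-! ### Examples: constants and negative powers -/

theorem trace_eq_of_continuousAt {s ρ : ℝ} (hs1 : s < 1) (hρ : ρ = s ∨ ρ = 1) {g : ℂ → ℂ} {θ : ℝ}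
    (hg : ContinuousAt g (pt ρ θ)) : trace s ρ g θ = g (pt ρ θ) := by
  have := neBot_nhdsWithin_Ioo hs1 hρ
  refine Tendsto.limUnder_eq ?_
  have h1 : Continuous fun r : ℝ => pt r θ := by unfold pt; fun_prop
  exact hg.tendsto.comp ((h1.tendsto ρ).mono_left nhdsWithin_le_nhds)

theorem linftyCircle_of_norm_trace_eq {s ρ c : ℝ} {g : ℂ → ℂ} (hg : ∀ θ, ‖trace s ρ g θ‖ = c) :
    linftyCircle s ρ g = ENNReal.ofReal c := by
  have hpi := Real.pi_pos
  have hμ : volume.restrict (Ioc (-Real.pi) Real.pi) ≠ 0 := by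
    rw [Ne, Measure.restrict_eq_zero, Real.volume_Ioc, ENNReal.ofReal_eq_zero]
    linarith
  have hc : 0 ≤ c := (norm_nonneg _).trans (hg 0).le
  rw [linftyCircle, eLpNorm_congr_norm_ae (g := fun _ => c)
    (Eventually.of_forall fun θ => by rw [hg θ, Real.norm_of_nonneg hc]),
    eLpNorm_exponent_top, eLpNormEssSup_const c hμ, Real.enorm_of_nonneg hc]

theorem l1Norm_circle_of_norm_trace_eq {s c : ℝ} {g : ℂ → ℂ} (hg : ∀ θ, ‖trace s 1 g θ‖ = c) :
    l1Norm s 1 (Metric.sphere 0 1) g = c := by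
  have hpi := Real.pi_pos
  have hang : angles 1 (Metric.sphere 0 1) = Ioc (-Real.pi) Real.pi := by
    ext θ
    simp only [angles, mem_ofPred_eq, mem_sphere_zero_iff_norm, norm_pt zero_le_one, and_true]
  have hvol : volume.real (Ioc (-Real.pi) Real.pi) = 2 * Real.pi := by
    rw [Real.volume_real_Ioc_of_le (by linarith)]; ring
  rw [l1Norm, proportion, hang]
  simp only [hg]
  rw [setIntegral_const, ← Measure.real, hvol, smul_eq_mul]
  field_simp

theorem linftyCircle_const {s ρ : ℝ} (hs1 : s < 1) (hρ : ρ = s ∨ ρ = 1) (c : ℂ) :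
    linftyCircle s ρ (fun _ => c) = ENNReal.ofReal ‖c‖ :=
  linftyCircle_of_norm_trace_eq fun θ => by
    rw [trace_eq_of_continuousAt hs1 hρ continuousAt_const]

theorem const_mem_unitBall {s a : ℝ} (k : ℕ) (hs1 : s < 1) (ha : 0 ≤ a) (ha2 : a ≤ 1 / 2) :
    (fun _ => (a : ℂ)) ∈ unitBall k s := by
  have hderiv : ∀ j, iteratedDeriv j (fun _ : ℂ => (a : ℂ)) = fun _ => if j = 0 then (a : ℂ) else 0 := by
    intro j
    ext z
    rw [iteratedDeriv_const]
  refine ⟨fun j _ => ?_, Finset.sup_le fun j _ => ?_⟩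
  · rw [hderiv]
    exact ⟨differentiableOn_const _, _, fun _ _ => le_rfl⟩
  · rw [hderiv, linftyCircle_const hs1 (Or.inl rfl), linftyCircle_const hs1 (Or.inr rfl),
      ← ENNReal.ofReal_add (norm_nonneg _) (norm_nonneg _), ENNReal.ofReal_le_one]
    split_ifs
    · rw [Complex.norm_real, Real.norm_of_nonneg ha]
      linarith
    · simp

/-- One factor `-log s` is paired with `s`: `log (2s) ≥ 1 - 1/(2s)` and `log 2 ≤ 1` give `-s log s ≤
(log 2)/2`. The other factors are at most `log 2`. -/
theorem mul_abs_log_pow_le {s : ℝ} {k : ℕ} (hk : 1 ≤ k) (hs : 1 / 2 ≤ s) (hs1 : s < 1) :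
    s * |Real.log s| ^ k ≤ 1 / 2 * |Real.log (1 / 2)| ^ k := by
  have hs0 : 0 < s := by linarith
  have h1 : |Real.log s| = -Real.log s := abs_of_neg (Real.log_neg hs0 hs1)
  have h2 : |Real.log (1 / 2)| = Real.log 2 := by
    rw [one_div, Real.log_inv, abs_neg, abs_of_pos (Real.log_pos one_lt_two)]
  obtain ⟨j, rfl⟩ : ∃ j, k = j + 1 := ⟨k - 1, by omega⟩
  have h3 : -Real.log s ≤ Real.log 2 := by
    rw [← Real.log_inv]
    refine Real.log_le_log (by positivity) ?_
    rw [inv_le_comm₀ hs0 two_pos]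
    linarith
  have h4 : s * -Real.log s ≤ 1 / 2 * Real.log 2 := by
    have h5 := Real.one_sub_inv_le_log_of_pos (by positivity : 0 < 2 * s)
    rw [Real.log_mul two_ne_zero hs0.ne'] at h5
    have h6 : s * (1 - (2 * s)⁻¹) = s - 1 / 2 := by field_simp
    have h7 := mul_le_mul_of_nonneg_left h5 hs0.le
    have h8 : Real.log 2 ≤ 1 := by linarith [Real.log_two_lt_d9]
    nlinarith
  have h9 : 0 ≤ -Real.log s := h1 ▸ abs_nonneg _
  have h10 : 0 ≤ Real.log 2 := h9.trans h3
  rw [h1, h2]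
  calc s * (-Real.log s) ^ (j + 1) = s * -Real.log s * (-Real.log s) ^ j := by ring
    _ ≤ 1 / 2 * Real.log 2 * Real.log 2 ^ j := by gcongr
    _ = _ := by ring

/-- The product `‖f‖_∞ |log ‖f‖₁| ^ k` on the outer circle tends to zero along any sequence in the
unit ball with `‖f‖₁ → 0`, since functions in the unit ball are Lipschitz. A sequence for which it
has a positive limit therefore stays away from zero; a constant one is enough. -/
theorem exists_outer_circle_lower_bound {k : ℕ} {s : ℝ} (hk : 1 ≤ k) (hs0 : 0 < s) (hs1 : s < 1) :
    ∃ f : ℕ → ℂ → ℂ, (∀ n, f n ∈ unitBall k s) ∧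
      ∃ l : ℝ, s * |Real.log s| ^ k ≤ l ∧
        Tendsto (fun n => (linftyCircle s 1 (f n)).toReal *
            |Real.log (l1Norm s 1 (Metric.sphere 0 1) (f n))| ^ k) atTop (𝓝 l) := by
  -- A constant counts on both circles in the norm, hence the cap `1/2`.
  set a : ℝ := min s (1 / 2) with ha
  have ha0 : 0 ≤ a := le_min hs0.le (by norm_num)
  refine ⟨fun _ _ => (a : ℂ), fun _ => const_mem_unitBall k hs1 ha0 (min_le_right _ _),
    a * |Real.log a| ^ k, ?_, ?_⟩
  · rcases le_total s (1 / 2) with h | h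
    · rw [ha, min_eq_left h]
    · rw [ha, min_eq_right h]
      exact mul_abs_log_pow_le hk h hs1
  · have hn : ‖(a : ℂ)‖ = a := by rw [Complex.norm_real, Real.norm_of_nonneg ha0]
    have h2 : l1Norm s 1 (Metric.sphere 0 1) (fun _ => (a : ℂ)) = a :=
      l1Norm_circle_of_norm_trace_eq fun θ => by
        rw [trace_eq_of_continuousAt hs1 (Or.inr rfl) continuousAt_const, hn]
    simp only [linftyCircle_const hs1 (Or.inr rfl), hn, h2, ENNReal.toReal_ofReal ha0]
    exact tendsto_const_nhds

/-- The modulus of the coefficient of the `j`-th derivative of `z ^ (-N)`. -/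
noncomputable def risingProd (j N : ℕ) : ℝ := ∏ i ∈ Finset.range j, ((N : ℝ) + i)

theorem risingProd_pos (j : ℕ) {N : ℕ} (hN : 1 ≤ N) : 0 < risingProd j N :=
  Finset.prod_pos fun i _ => by
    have : (1 : ℝ) ≤ N := by exact_mod_cast hN
    positivity

theorem risingProd_mono {j k N : ℕ} (hN : 1 ≤ N) (hjk : j ≤ k) : risingProd j N ≤ risingProd k N := by
  induction hjk with
  | refl => exact le_rfl
  | step h ih =>
    refine ih.trans ?_
    rw [risingProd, risingProd, Finset.prod_range_succ]
    refine le_mul_of_one_le_right (risingProd_pos _ hN).le ?_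
    have : (1 : ℝ) ≤ N := by exact_mod_cast hN
    have h2 := Nat.cast_nonneg (α := ℝ) ‹ℕ›
    linarith

theorem one_le_risingProd (k : ℕ) {N : ℕ} (hN : 1 ≤ N) : 1 ≤ risingProd k N := by
  simpa [risingProd] using risingProd_mono hN (Nat.zero_le k)

theorem iteratedDeriv_const_mul_zpow (c : ℂ) (N j : ℕ) :
    iteratedDeriv j (fun z : ℂ => c * z ^ (-(N : ℤ))) =
      fun z => c * ((∏ i ∈ Finset.range j, (((-(N : ℤ) : ℤ) : ℂ) - i)) * z ^ (-(N : ℤ) - j)) := by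
  have h : ∀ (F : ℂ → ℂ) (j : ℕ), deriv^[j] (fun z => c * F z) = fun z => c * deriv^[j] F z := by
    intro F j
    induction j with
    | zero => rfl
    | succ j ih =>
      rw [Function.iterate_succ_apply', Function.iterate_succ_apply', ih]
      exact deriv_const_mul_field' c
  rw [iteratedDeriv_eq_iterate, h, iter_deriv_zpow']

theorem norm_iteratedDeriv_const_mul_zpow {c : ℝ} (hc : 0 ≤ c) {N : ℕ} (j : ℕ) (z : ℂ) :
    ‖iteratedDeriv j (fun z : ℂ => (c : ℂ) * z ^ (-(N : ℤ))) z‖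
      = c * risingProd j N * (‖z‖ ^ (N + j))⁻¹ := by
  rw [iteratedDeriv_const_mul_zpow]
  simp only [norm_mul, norm_prod, norm_zpow]
  rw [Complex.norm_real, Real.norm_of_nonneg hc, mul_assoc, risingProd]
  congr 2
  · refine Finset.prod_congr rfl fun i _ => ?_
    rw [← norm_neg]
    have : -(((-(N : ℤ) : ℤ) : ℂ) - i) = ((N + i : ℝ) : ℂ) := by push_cast; ring
    rw [this, Complex.norm_real, Real.norm_of_nonneg (by positivity)]
  · rw [show -(N : ℤ) - j = -((N + j : ℕ) : ℤ) by push_cast; ring, zpow_neg, zpow_natCast]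

theorem differentiableAt_iteratedDeriv_const_mul_zpow (c : ℂ) (N j : ℕ) {z : ℂ} (hz : z ≠ 0) :
    DifferentiableAt ℂ (iteratedDeriv j (fun z : ℂ => c * z ^ (-(N : ℤ)))) z := by
  rw [iteratedDeriv_const_mul_zpow]
  exact ((differentiableAt_zpow.2 (Or.inl hz)).const_mul _).const_mul _

theorem norm_trace_iteratedDeriv_const_mul_zpow {s ρ c : ℝ} (hs0 : 0 < s) (hs1 : s < 1)
    (hρ : ρ = s ∨ ρ = 1) (hc : 0 ≤ c) {N : ℕ} (j : ℕ) (θ : ℝ) :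
    ‖trace s ρ (iteratedDeriv j (fun z : ℂ => (c : ℂ) * z ^ (-(N : ℤ)))) θ‖
      = c * risingProd j N * (ρ ^ (N + j))⁻¹ := by
  have hρ0 : 0 < ρ := by rcases hρ with rfl | rfl <;> linarith
  have hn := norm_pt hρ0.le θ
  have hne : pt ρ θ ≠ 0 := norm_pos_iff.1 (hρ0.trans_eq hn.symm)
  rw [trace_eq_of_continuousAt hs1 hρ
    (differentiableAt_iteratedDeriv_const_mul_zpow _ N j hne).continuousAt,
    norm_iteratedDeriv_const_mul_zpow hc, hn]

/-- The constant that normalizes `z ^ (-N)` in the Hardy-Sobolev norm. -/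
noncomputable def zpowCoeff (k : ℕ) (s : ℝ) (N : ℕ) : ℝ := s ^ (N + k) / (risingProd k N * (1 + s ^ (N + k)))

theorem zpowCoeff_pos {k N : ℕ} {s : ℝ} (hs0 : 0 < s) (hN : 1 ≤ N) : 0 < zpowCoeff k s N := by
  have := risingProd_pos k hN
  unfold zpowCoeff
  positivity

/-- The derivative of order `k` has the largest norm, and the coefficient makes it exactly `1`. -/
theorem zpow_mem_unitBall {k N : ℕ} {s : ℝ} (hs0 : 0 < s) (hs1 : s < 1) (hN : 1 ≤ N) :
    (fun z : ℂ => (zpowCoeff k s N : ℂ) * z ^ (-(N : ℤ))) ∈ unitBall k s := by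
  set c := zpowCoeff k s N with hc
  have hc0 : 0 < c := zpowCoeff_pos hs0 hN
  have hnn : ∀ (j : ℕ) {x : ℝ}, 0 < x → 0 ≤ c * risingProd j N * (x ^ (N + j))⁻¹ := by
    intro j x hx
    have := risingProd_pos j hN
    positivity
  refine ⟨fun j _ => ⟨fun z hz => ?_, c * risingProd j N * (s ^ (N + j))⁻¹, fun z hz => ?_⟩,
    Finset.sup_le fun j hj => ?_⟩
  · exact (differentiableAt_iteratedDeriv_const_mul_zpow _ N j
      (norm_pos_iff.1 (hs0.trans hz.1))).differentiableWithinAt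
  · rw [norm_iteratedDeriv_const_mul_zpow hc0.le]
    have := risingProd_pos j hN
    gcongr
    exact hz.1.le
  · have hjk : j ≤ k := by
      have := Finset.mem_range.1 hj
      omega
    rw [linftyCircle_of_norm_trace_eq
        (norm_trace_iteratedDeriv_const_mul_zpow hs0 hs1 (Or.inl rfl) hc0.le j),
      linftyCircle_of_norm_trace_eq
        (norm_trace_iteratedDeriv_const_mul_zpow hs0 hs1 (Or.inr rfl) hc0.le j),
      ← ENNReal.ofReal_add (hnn j hs0) (hnn j one_pos), ENNReal.ofReal_le_one]
    have h1 := risingProd_pos k hN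
    have h2 : (s ^ (N + j))⁻¹ ≤ (s ^ (N + k))⁻¹ := by
      gcongr ?_⁻¹
      exact pow_le_pow_of_le_one hs0.le hs1.le (by omega)
    calc _ = c * risingProd j N * ((s ^ (N + j))⁻¹ + 1) := by simp; ring
      _ ≤ c * risingProd k N * ((s ^ (N + k))⁻¹ + 1) := by
        gcongr
        exact risingProd_mono hN hjk
      _ = 1 := by
        rw [hc, zpowCoeff]
        field_simp

theorem tendsto_pow_div_risingProd (k : ℕ) :
    Tendsto (fun n : ℕ => ((n + 1 : ℕ) : ℝ) ^ k / risingProd k (n + 1)) atTop (𝓝 1) := by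
  have h1 : ∀ n : ℕ, ((n + 1 : ℕ) : ℝ) ^ k / risingProd k (n + 1)
      = ∏ i ∈ Finset.range k, (((n + 1 : ℕ) : ℝ) / (((n + 1 : ℕ) : ℝ) + i)) := by
    intro n
    rw [Finset.prod_div_distrib, Finset.prod_const, Finset.card_range, risingProd]
  simp only [h1]
  have h2 : ∀ i ∈ Finset.range k, Tendsto
      (fun n : ℕ => ((n + 1 : ℕ) : ℝ) / (((n + 1 : ℕ) : ℝ) + i)) atTop (𝓝 1) := fun i _ =>
    (tendsto_natCast_div_add_atTop (i : ℝ)).comp (tendsto_add_atTop_nat 1)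
  simpa using tendsto_finsetProd _ h2

theorem tendsto_pow_zero {s : ℝ} (hs0 : 0 < s) (hs1 : s < 1) (k : ℕ) :
    Tendsto (fun n : ℕ => s ^ (n + 1 + k)) atTop (𝓝 0) := by
  have := (tendsto_pow_atTop_nhds_zero_of_lt_one hs0.le hs1).comp (tendsto_add_atTop_nat (1 + k))
  refine this.congr fun n => ?_
  simp only [Function.comp, add_assoc]

theorem neg_log_zpowCoeff {k N : ℕ} {s : ℝ} (hs0 : 0 < s) (hN : 1 ≤ N) :
    -Real.log (zpowCoeff k s N) =
      -(N + k) * Real.log s + (k * Real.log N - Real.log ((N : ℝ) ^ k / risingProd k N))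
        + Real.log (1 + s ^ (N + k)) := by
  have h1 := risingProd_pos k hN
  have h2 : (0 : ℝ) < N := by exact_mod_cast hN
  have h3 : 0 < s ^ (N + k) := by positivity
  rw [zpowCoeff, Real.log_div h3.ne' (by positivity), Real.log_mul h1.ne' (by positivity),
    Real.log_div (by positivity) h1.ne', Real.log_pow, Real.log_pow]
  push_cast
  ring

/-- Only `s^N` contributes at order `N`: the rising product is asymptotic to `N^k`, whose logarithm
is `o(N)`. -/
theorem tendsto_neg_log_zpowCoeff_div (k : ℕ) {s : ℝ} (hs0 : 0 < s) (hs1 : s < 1) :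
    Tendsto (fun n : ℕ => -Real.log (zpowCoeff k s (n + 1)) / ((n + 1 : ℕ) : ℝ)) atTop
      (𝓝 (-Real.log s)) := by
  have hN : Tendsto (fun n : ℕ => ((n + 1 : ℕ) : ℝ)) atTop atTop :=
    tendsto_natCast_atTop_atTop.comp (tendsto_add_atTop_nat 1)
  have hinv : Tendsto (fun n : ℕ => ((n + 1 : ℕ) : ℝ)⁻¹) atTop (𝓝 0) := tendsto_inv_atTop_zero.comp hN
  have h1 : Tendsto (fun n : ℕ => Real.log ((n + 1 : ℕ) : ℝ) / ((n + 1 : ℕ) : ℝ)) atTop (𝓝 0) :=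
    Real.isLittleO_log_id_atTop.tendsto_div_nhds_zero.comp hN
  have h2 : Tendsto (fun n : ℕ => Real.log (((n + 1 : ℕ) : ℝ) ^ k / risingProd k (n + 1))) atTop
      (𝓝 0) := by
    have := (Real.continuousAt_log one_ne_zero).tendsto.comp (tendsto_pow_div_risingProd k)
    rwa [Real.log_one] at this
  have h3 : Tendsto (fun n : ℕ => Real.log (1 + s ^ (n + 1 + k))) atTop (𝓝 0) := by
    have h4 : Tendsto (fun n : ℕ => 1 + s ^ (n + 1 + k)) atTop (𝓝 1) := by
      simpa using (tendsto_pow_zero hs0 hs1 k).const_add 1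
    have := (Real.continuousAt_log one_ne_zero).tendsto.comp h4
    rwa [Real.log_one] at this
  have hlim : Tendsto (fun n : ℕ => -(1 + k * ((n + 1 : ℕ) : ℝ)⁻¹) * Real.log s
      + (k * (Real.log ((n + 1 : ℕ) : ℝ) / ((n + 1 : ℕ) : ℝ))
        - Real.log (((n + 1 : ℕ) : ℝ) ^ k / risingProd k (n + 1)) * ((n + 1 : ℕ) : ℝ)⁻¹)
      + Real.log (1 + s ^ (n + 1 + k)) * ((n + 1 : ℕ) : ℝ)⁻¹) atTop
      (𝓝 (-(1 + k * 0) * Real.log s + (k * 0 - 0 * 0) + 0 * 0)) :=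
    ((((hinv.const_mul _).const_add 1).neg.mul_const _).add
      ((h1.const_mul _).sub (h2.mul hinv))).add (h3.mul hinv)
  have hval : -(1 + k * 0) * Real.log s + (k * 0 - 0 * 0) + 0 * 0 = -Real.log s := by ring
  rw [hval] at hlim
  refine hlim.congr fun n => ?_
  rw [neg_log_zpowCoeff hs0 (by omega)]
  have : ((n + 1 : ℕ) : ℝ) ≠ 0 := by positivity
  field_simp

theorem exists_optimal_sequence {k : ℕ} {s : ℝ} (hs0 : 0 < s) (hs1 : s < 1) :
    ∃ f : ℕ → ℂ → ℂ, (∀ n, f n ∈ unitBall k s) ∧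
      (∀ n, 0 < l1Norm s 1 (Metric.sphere 0 1) (f n)) ∧
      Tendsto (fun n => l1Norm s 1 (Metric.sphere 0 1) (f n)) atTop (𝓝 0) ∧
      ∃ l : ℝ, s ^ k * |Real.log s| ^ k ≤ l ∧
        Tendsto (fun n => (linftyBoundary s (f n)).toReal *
            |Real.log (l1Norm s 1 (Metric.sphere 0 1) (f n))| ^ k) atTop (𝓝 l) := by
  set c : ℕ → ℝ := fun n => zpowCoeff k s (n + 1) with hc
  set f : ℕ → ℂ → ℂ := fun n z => (c n : ℂ) * z ^ (-((n + 1 : ℕ) : ℤ)) with hf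
  have hc0 : ∀ n, 0 < c n := fun n => zpowCoeff_pos hs0 (by omega)
  have htr : ∀ n, ∀ ρ, ρ = s ∨ ρ = 1 → ∀ θ, ‖trace s ρ (f n) θ‖ = c n * (ρ ^ (n + 1))⁻¹ := by
    intro n ρ hρ θ
    have := norm_trace_iteratedDeriv_const_mul_zpow hs0 hs1 hρ (hc0 n).le (N := n + 1) 0 θ
    simpa only [iteratedDeriv_zero, risingProd, Finset.range_zero, Finset.prod_empty, mul_one,
      add_zero] using this
  have hl1 : ∀ n, l1Norm s 1 (Metric.sphere 0 1) (f n) = c n := fun n =>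
    l1Norm_circle_of_norm_trace_eq fun θ => by rw [htr n 1 (Or.inr rfl)]; simp
  have hpow : ∀ n : ℕ, (0 : ℝ) < s ^ (n + 1 + k) := fun n => by positivity
  have hcle : ∀ n, c n ≤ s ^ (n + 1 + k) := by
    intro n
    have := one_le_risingProd k (N := n + 1) (by omega)
    refine div_le_self (hpow n).le ?_
    nlinarith [hpow n]
  have hclt : ∀ n, c n < 1 := fun n =>
    (hcle n).trans_lt (pow_lt_one₀ hs0.le hs1 (by omega))
  have hlinf : ∀ n, (linftyBoundary s (f n)).toReal = c n * (s ^ (n + 1))⁻¹ := by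
    intro n
    rw [linftyBoundary, linftyCircle_of_norm_trace_eq (htr n s (Or.inl rfl)),
      linftyCircle_of_norm_trace_eq (htr n 1 (Or.inr rfl)), max_eq_left, ENNReal.toReal_ofReal]
    · have := hc0 n
      positivity
    · refine ENNReal.ofReal_le_ofReal ?_
      have := (hc0 n).le
      gcongr
  refine ⟨f, fun n => zpow_mem_unitBall hs0 hs1 (by omega), fun n => by rw [hl1]; exact hc0 n, ?_,
    s ^ k * |Real.log s| ^ k, le_rfl, ?_⟩
  · simp only [hl1]
    exact squeeze_zero (fun n => (hc0 n).le) hcle (tendsto_pow_zero hs0 hs1 k)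
  · have h1 : Tendsto (fun n : ℕ => (1 + s ^ (n + 1 + k))⁻¹) atTop (𝓝 1) := by
      have := ((tendsto_pow_zero hs0 hs1 k).const_add 1).inv₀ (by norm_num)
      simpa using this
    have hlim := ((h1.const_mul (s ^ k)).mul (tendsto_pow_div_risingProd k)).mul
      ((tendsto_neg_log_zpowCoeff_div k hs0 hs1).pow k)
    rw [mul_one, mul_one] at hlim
    rw [abs_of_neg (Real.log_neg hs0 hs1)]
    refine hlim.congr fun n => ?_
    rw [hl1, hlinf, abs_of_neg (Real.log_neg (hc0 n) (hclt n)), div_pow]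
    have h2 := risingProd_pos k (N := n + 1) (by omega)
    have h3 : ((n + 1 : ℕ) : ℝ) ≠ 0 := by positivity
    have h4 := hpow n
    -- The powers `s^N` cancel in the boundary norm, leaving a quantity asymptotic to `s^k / N^k`
    -- that balances `|log c|^k`, asymptotic to `N^k |log s|^k`.
    have h5 : c n * (s ^ (n + 1))⁻¹ = s ^ k * (1 + s ^ (n + 1 + k))⁻¹ * (risingProd k (n + 1))⁻¹ := by
      simp only [hc, zpowCoeff]
      rw [pow_add s (n + 1) k]
      field_simp
    rw [h5]
    simp only [hc]
    field_simp

end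

end HardyAnnulus

theorem theorem3p7 (k : ℕ) (hk : 1 ≤ k) (s : ℝ) (hs0 : 0 < s) (hs1 : s < 1) :
    -- the estimate, with a constant that depends only on `k`, `s` and the proportion `lam` of `I`
    (∀ lam : ℝ, 0 < lam → lam ≤ 1 →
      ∃ C : ℝ, 0 ≤ C ∧
        ∀ (r : ℝ) (I : Set ℂ), HardyAnnulus.IsArc s r I → HardyAnnulus.proportion r I = lam →
          ∀ f ∈ HardyAnnulus.unitBall k s,
            HardyAnnulus.l1Norm s r I f
                < Real.exp (-(HardyAnnulus.q0 s / (lam * HardyAnnulus.Cs s))) →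
              HardyAnnulus.linftyBoundary s f ≤
                ENNReal.ofReal (C / |Real.log (HardyAnnulus.l1Norm s r I f)| ^ k)) ∧
    -- the lower bound on the outer circle
    (∃ f : ℕ → ℂ → ℂ, (∀ n, f n ∈ HardyAnnulus.unitBall k s) ∧
      ∃ l : ℝ, s * |Real.log s| ^ k ≤ l ∧
        Filter.Tendsto (fun n => (HardyAnnulus.linftyCircle s 1 (f n)).toReal *
            |Real.log (HardyAnnulus.l1Norm s 1 (Metric.sphere 0 1) (f n))| ^ k)
          Filter.atTop (nhds l)) ∧
    -- optimality of the exponent `k`, along functions whose `L^1` norm on `𝕋` tends to zero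
    (∃ f : ℕ → ℂ → ℂ, (∀ n, f n ∈ HardyAnnulus.unitBall k s) ∧
      (∀ n, 0 < HardyAnnulus.l1Norm s 1 (Metric.sphere 0 1) (f n)) ∧
      Filter.Tendsto (fun n => HardyAnnulus.l1Norm s 1 (Metric.sphere 0 1) (f n))
        Filter.atTop (nhds 0) ∧
      ∃ l : ℝ, s ^ k * |Real.log s| ^ k ≤ l ∧
        Filter.Tendsto (fun n => (HardyAnnulus.linftyBoundary s (f n)).toReal *
            |Real.log (HardyAnnulus.l1Norm s 1 (Metric.sphere 0 1) (f n))| ^ k)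
          Filter.atTop (nhds l)) := by
  exact ⟨fun _ hlam hlam1 => HardyAnnulus.upper_estimate hs0 hs1 hk hlam hlam1,
    HardyAnnulus.exists_outer_circle_lower_bound hk hs0 hs1,
    HardyAnnulus.exists_optimal_sequence hs0 hs1⟩
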